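/- Let $d,q\ge 1$. Write $|\cdot|$ for the Euclidean norm on $\mathbb R^d$, $\overline{\mathbb R}=[-\infty,\infty]$ and $\overline{\mathbb R}^d_0=\overline{\mathbb R}^d\setminus\{0\}$. Vague convergence $\kappa_s\xrightarrow{v}\mu$ as $s\to\infty$ means $\int f\,d\kappa_s\to\int f\,d\mu$ for every continuous compactly supported $f:\overline{\mathbb R}^d_0\to\mathbb R$. A random vector $X$ in $\mathbb R^d$ is regularly varying with index $\alpha>0$ and tail measure $\mu_X$, written $X\in \mathrm{RV}(\alpha,\mu_X)$, if $\mu_X$ is a non-null Radon measure on $\overline{\mathbb R}^d_0$ that does not charge the set of points with an infinite coordinate, $\mu_X(tA)=t^{-\alpha}\mu_X(A)$ for all $t>0$ and all Borel sets $A\subset\overline{\mathbb R}^d_0$, and $$\frac{P(s^{-1}X\in\cdot)}{P(|X|>s)}\xrightarrow{v}\mu_X,\qquad s\to\infty .$$ **Theorem.** Let $Z,Z_1,\dots,Z_q$ be identically distributed $\mathbb R^d$-valued random vectors with $Z_1,\dots,Z_q$ independent, let $\Psi_1,\dots,\Psi_q$ be deterministic invertible real $d\times d$ matrices, and let $X=\sum_{j=1}^q\Psi_jZ_j$.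 Assume that $X\in \mathrm{RV}(\alpha,\mu_X)$ for some $\alpha>0$ and that $$\gamma(\Psi_1)^{\alpha}>\sum_{j=2}^q\|\Psi_j\|^{\alpha},$$ where $\gamma(\Psi_1)=\min_{|z|=1}|\Psi_1z|$ and $\|\Psi_j\|$ is the operator norm of $\Psi_j$ with respect to $|\cdot|$. Then there is a measure $\mu_Z$ on $\overline{\mathbb R}^d_0$ such that $Z\in \mathrm{RV}(\alpha,\mu_Z)$ and $$\frac{P(s^{-1}X\in\cdot)}{P(|Z|>s)}\xrightarrow{v}\sum_{j=1}^q\mu_Z\circ\Psi_j^{-1},\qquad s\to\infty ,$$ where $(\mu_Z\circ\Psi_j^{-1})(B)=\mu_Z(\{x\in\mathbb R^d\setminus\{0\}:\Psi_jx\in B\})$. -/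

import Mathlib

open MeasureTheory ProbabilityTheory Filter Topology
open scoped CompactlySupported

/-- The punctured compactified space `[-∞,∞]^d \ {0}`, with the subspace topology and its Borel
σ-algebra. -/
abbrev ExtPunctured (d : ℕ) : Type := {x : Fin d → EReal // x ≠ 0}

/-- The inclusion of `ℝ^d \ {0}` into `[-∞,∞]^d \ {0}`. -/
def finiteIncl (d : ℕ) (x : {x : EuclideanSpace ℝ (Fin d) // x ≠ 0}) : ExtPunctured d :=
  ⟨fun i => (x.1 i : EReal), fun h => x.2 (by
    ext i
    simpa using congrFun h i)⟩

/-- The points of `[-∞,∞]^d \ {0}` having an infinite coordinate. -/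
def infinitePoints (d : ℕ) : Set (ExtPunctured d) :=
  {x | ∃ i, x.1 i = ⊤ ∨ x.1 i = ⊥}

/-- A Borel measure on `ℝ^d`, restricted to `ℝ^d \ {0}` and viewed as a measure on
`[-∞,∞]^d \ {0}`. -/
noncomputable def toExt {d : ℕ} (ν : Measure (EuclideanSpace ℝ (Fin d))) :
    Measure (ExtPunctured d) :=
  (ν.comap (Subtype.val : {x : EuclideanSpace ℝ (Fin d) // x ≠ 0} → _)).map (finiteIncl d)

/-- The restriction of a measure on `[-∞,∞]^d \ {0}` to the finite points, viewed as a measure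
on `ℝ^d`. -/
noncomputable def finitePart {d : ℕ} (μ : Measure (ExtPunctured d)) :
    Measure (EuclideanSpace ℝ (Fin d)) :=
  (μ.comap (finiteIncl d)).map Subtype.val

/-- The image `μ ∘ Ψ⁻¹` on `[-∞,∞]^d \ {0}`, under a matrix `Ψ`, of a measure `μ` that does not
charge the infinite points. -/
noncomputable def linearImage {d : ℕ} (Ψ : Matrix (Fin d) (Fin d) ℝ)
    (μ : Measure (ExtPunctured d)) : Measure (ExtPunctured d) :=
  toExt ((finitePart μ).map (Matrix.toEuclideanCLM (𝕜 := ℝ) Ψ))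

/-- Vague convergence `κ s → μ` as `s → ∞` on `[-∞,∞]^d \ {0}`: convergence of the integrals of
all continuous functions with compact support. -/
def VagueTendsto {d : ℕ} (κ : ℝ → Measure (ExtPunctured d)) (μ : Measure (ExtPunctured d)) :
    Prop :=
  ∀ f : C_c(ExtPunctured d, ℝ),
    Tendsto (fun s => ∫ x, f x ∂(κ s)) atTop (𝓝 (∫ x, f x ∂μ))

/-- The measure `B ↦ ν (s B) / ρ {y : |y| > s}` on `[-∞,∞]^d \ {0}`. For the laws `ν` of `X` and
`ρ` of `Z` it is `P(s⁻¹ X ∈ ·) / P(|Z| > s)`. -/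
noncomputable def scaledRatio {d : ℕ} (ν ρ : Measure (EuclideanSpace ℝ (Fin d))) (s : ℝ) :
    Measure (ExtPunctured d) :=
  (ρ {y | s < ‖y‖})⁻¹ • toExt (ν.map (fun x => s⁻¹ • x))

/-- The dilated set `t A` in `[-∞,∞]^d \ {0}`. -/
def dilate {d : ℕ} (t : ℝ) (A : Set (ExtPunctured d)) : Set (ExtPunctured d) :=
  {x | ∃ a ∈ A, ∀ i, x.1 i = (t : EReal) * a.1 i}

/-- `ν ∈ RV(α, μ)`: the measure `ν` on `ℝ^d` is regularly varying with index `α` and tail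
measure `μ`. -/
structure IsRegularlyVarying {d : ℕ} (ν : Measure (EuclideanSpace ℝ (Fin d))) (α : ℝ)
    (μ : Measure (ExtPunctured d)) : Prop where
  index_pos : 0 < α
  ne_zero : μ ≠ 0
  radon : IsFiniteMeasureOnCompacts μ
  infinitePoints_null : μ (infinitePoints d) = 0
  tendsto : VagueTendsto (scaledRatio ν ν) μ
  homogeneous : ∀ t : ℝ, 0 < t → ∀ A : Set (ExtPunctured d), MeasurableSet A →
    μ (dilate t A) = ENNReal.ofReal (t ^ (-α)) * μ A

/-- The minimal stretch `γ(Ψ) = min {|Ψ z| : |z| = 1}` for the Euclidean norm. -/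
noncomputable def minStretch {d : ℕ} (Ψ : Matrix (Fin d) (Fin d) ℝ) : ℝ :=
  sInf ((fun z => ‖Matrix.toEuclideanCLM (𝕜 := ℝ) Ψ z‖) ''
    Metric.sphere (0 : EuclideanSpace ℝ (Fin d)) 1)

/-- The operator norm of `Ψ` for the Euclidean norm. -/
noncomputable def matrixOpNorm {d : ℕ} (Ψ : Matrix (Fin d) (Fin d) ℝ) : ℝ :=
  ‖Matrix.toEuclideanCLM (𝕜 := ℝ) Ψ‖

/-! Let ν and ζ be the laws of X and of Z, and for bounded continuous g vanishing near 0 put K g(s)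
= E g(Z/s) / P(|X| > s), which is `ratio ζ ν g s`. The numbering of the summands starts at 0, so `Ψ
0` is the dominant matrix.

The tail of X controls that of Z: if |Z_0| is large while the other summands stay bounded, then |X|
is large, and by independence the second event costs only a constant factor
(`eventually_tail_summand_le`). Hence |K g| is eventually at most a constant times B ε^(-α), where B
bounds g and g vanishes on the ball of radius ε.

With such tails, two summands are rarely large together, so E g(X/s) is the sum of the E g(Ψ_j
Z_j/s) up to o(P(|X| > s)) (`tendsto_single_big_jump`). Thus the sum of the K(g ∘ Ψ_j) converges to
the integral of g against μ_X. Replacing g by g ∘ Ψ_0⁻¹ shows that K g + ∑_{j ≠ 0} K(g ∘ Ψ_0⁻¹ Ψ_j)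
converges. Precomposition with Ψ_0⁻¹ Ψ_j multiplies the bound B ε^(-α) by at most (‖Ψ_j‖/γ)^α, and
by hypothesis these factors add up to less than 1. Iterating, the oscillation of K g at infinity is
below a geometric sequence, hence zero, and K g converges (`exists_tendsto_of_contraction`).

The Riesz theorem turns the limits into a measure μ. The bound on K prevents mass at infinity, and
the regular variation of the tail of X gives homogeneity (`exists_homogeneous_measure`). Homogeneity
also gives P(|Z| > s)/P(|X| > s) → M = μ{|x| > 1}; M is positive because μ_X is non-null, and μ_Z =
μ/M. -/

/-! ### Topology of the punctured compactification and coordinatewise truncation. -/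

section Space

variable {d : ℕ}

instance ExtPunctured.secondCountableTopology : SecondCountableTopology (ExtPunctured d) :=
  TopologicalSpace.Subtype.secondCountableTopology _

instance ExtPunctured.locallyCompactSpace : LocallyCompactSpace (ExtPunctured d) :=
  (isOpen_compl_singleton (x := (0 : Fin d → EReal))).isOpenEmbedding_subtypeVal.locallyCompactSpace

/-- Regularity is what lets integrals of compactly supported functions determine the measure. -/
theorem ExtPunctured.regular_of_isFiniteMeasureOnCompacts (μ : Measure (ExtPunctured d))
    [IsFiniteMeasureOnCompacts μ] : μ.Regular := by
  let _ := TopologicalSpace.metrizableSpaceMetric (ExtPunctured d)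
  infer_instance

/-- A closed set of `[-∞,∞]^d` avoiding a neighbourhood of `0` is compact in the punctured space. -/
theorem ExtPunctured.isCompact_preimage_val {K : Set (Fin d → EReal)} (hK : IsClosed K)
    (h0 : (0 : Fin d → EReal) ∉ K) : IsCompact ((Subtype.val : ExtPunctured d → _) ⁻¹' K) := by
  refine Topology.IsInducing.subtypeVal.isCompact_preimage' hK.isCompact ?_
  intro x hx
  exact ⟨⟨x, fun h => h0 (h ▸ hx)⟩, rfl⟩

/-- A continuous function on `[-∞,∞]^d` vanishing near `0`, as a compactly supported function on
the punctured space. -/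
noncomputable def ofVanishing (F : (Fin d → EReal) → ℝ) (hF : Continuous F)
    (h0 : ∀ᶠ x in 𝓝 0, F x = 0) : C_c(ExtPunctured d, ℝ) where
  toFun x := F x.1
  continuous_toFun := hF.comp continuous_subtype_val
  hasCompactSupport' := by
    obtain ⟨U, hU, hUo, h0U⟩ := eventually_nhds_iff.1 h0
    refine HasCompactSupport.of_support_subset_isCompact
      (ExtPunctured.isCompact_preimage_val hUo.isClosed_compl (fun h => h h0U)) ?_
    intro x hx hxU
    exact hx (hU _ hxU)

/-- The inclusion of `ℝ^d` into `[-∞,∞]^d`. -/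
def coeExt (x : EuclideanSpace ℝ (Fin d)) : Fin d → EReal := fun i => (x i : EReal)

theorem continuous_coeExt : Continuous (coeExt (d := d)) :=
  continuous_pi fun i => continuous_coe_real_ereal.comp (by fun_prop)

theorem coeExt_zero : coeExt (0 : EuclideanSpace ℝ (Fin d)) = 0 := by
  ext i; simp [coeExt]

/-- Coordinatewise truncation of `[-∞,∞]^d` to `[-R,R]^d`. -/
noncomputable def clampExt (R : ℝ) (x : Fin d → EReal) : EuclideanSpace ℝ (Fin d) :=
  WithLp.toLp 2 fun i => (max ((-R : ℝ) : EReal) (min (x i) (R : EReal))).toReal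

theorem continuous_clampExt (R : ℝ) : Continuous (clampExt (d := d) R) := by
  refine (PiLp.continuous_toLp 2 _).comp (continuous_pi fun i => ?_)
  refine EReal.continuousOn_toReal.comp_continuous (by fun_prop) fun x => ?_
  simp only [Set.mem_compl_iff, Set.mem_insert_iff, Set.mem_singleton_iff, not_or]
  constructor
  · exact ((EReal.bot_lt_coe _).trans_le (le_max_left _ _)).ne'
  · exact (max_lt (EReal.coe_lt_top _) ((min_le_right _ _).trans_lt (EReal.coe_lt_top _))).ne

theorem clampExt_apply_coe (R : ℝ) (x : Fin d → EReal) (i : Fin d) (a : ℝ) (h : x i = a) :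
    clampExt R x i = max (-R) (min a R) := by
  simp only [clampExt, h]
  have hm : Monotone ((↑) : ℝ → EReal) := fun a b hab => EReal.coe_le_coe_iff.2 hab
  rw [← hm.map_min, ← hm.map_max, EReal.toReal_coe]

theorem clampExt_zero {R : ℝ} (hR : 0 ≤ R) : clampExt R (0 : Fin d → EReal) = 0 := by
  ext i
  rw [clampExt_apply_coe R _ i 0 rfl]
  simp [hR]

/-- A point which truncation at level `R` moves has a truncation of norm at least `R`. -/
theorem eq_coeExt_clampExt_or_le_norm {R : ℝ} (hR : 0 ≤ R) (x : Fin d → EReal) :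
    coeExt (clampExt R x) = x ∨ R ≤ ‖clampExt R x‖ := by
  by_cases h : ∀ i, |clampExt R x i| < R
  · left
    ext i
    have hi := h i
    simp only [coeExt]
    induction hxi : x i with
    | bot =>
      exfalso
      simp [clampExt, hxi, abs_of_nonneg hR] at hi
    | top =>
      exfalso
      simp [clampExt, hxi] at hi
      rw [max_eq_right (by exact_mod_cast (by linarith : -R ≤ R)), EReal.toReal_coe,
        abs_of_nonneg hR] at hi
      exact lt_irrefl _ hi
    | coe a =>
      rw [clampExt_apply_coe R x i a hxi] at hi ⊢
      rw [abs_lt] at hi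
      congr 1
      rcases le_total a R with h1 | h1
      · rw [min_eq_left h1] at hi ⊢
        rcases le_total (-R) a with h2 | h2
        · exact max_eq_right h2
        · rw [max_eq_left h2] at hi
          linarith [hi.1]
      · rw [min_eq_right h1, max_eq_right (by linarith)] at hi
        linarith [hi.2]
  · right
    push Not at h
    obtain ⟨i, hi⟩ := h
    refine hi.trans ?_
    simpa using PiLp.norm_apply_le (clampExt R x) i

theorem clampExt_coeExt {R : ℝ} {x : EuclideanSpace ℝ (Fin d)} (h : ‖x‖ ≤ R) :
    clampExt R (coeExt x) = x := by
  ext i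
  rw [clampExt_apply_coe R _ i (x i) rfl]
  have := abs_le.1 ((PiLp.norm_apply_le x i).trans h)
  rw [min_eq_left this.2, max_eq_right this.1]

theorem norm_clampExt_coeExt_le (R : ℝ) (hR : 0 ≤ R) (x : EuclideanSpace ℝ (Fin d)) :
    ‖clampExt R (coeExt x)‖ ≤ ‖x‖ := by
  rw [EuclideanSpace.norm_eq, EuclideanSpace.norm_eq]
  refine Real.sqrt_le_sqrt (Finset.sum_le_sum fun i _ => ?_)
  rw [clampExt_apply_coe R _ i (x i) rfl]
  gcongr
  simp only [Real.norm_eq_abs]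
  rcases le_total (x i) R with h1 | h1
  · rw [min_eq_left h1]
    rcases le_total (-R) (x i) with h2 | h2
    · rw [max_eq_right h2]
    · rw [max_eq_left h2, abs_neg, abs_of_nonneg hR, abs_of_nonpos (by linarith)]
      linarith
  · rw [min_eq_right h1, max_eq_right (by linarith), abs_of_nonneg hR, abs_of_nonneg (by linarith)]
    exact h1

/-- Truncation at level `R` has not moved such a point, so a higher level does not move it either.
This permits bounds uniform in the level. -/
theorem clampExt_eq_of_norm_lt {R S : ℝ} (hR : 0 ≤ R) (hRS : R ≤ S) {x : Fin d → EReal}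
    (h : ‖clampExt R x‖ < R) : clampExt S x = clampExt R x := by
  rcases eq_coeExt_clampExt_or_le_norm hR x with h1 | h1
  · conv_lhs => rw [← h1]
    exact clampExt_coeExt (h.le.trans hRS)
  · exact absurd h (not_lt.2 h1)

end Space

/-! ### Transfer of functions and integrals between `ℝ^d` and the punctured compactification. -/

section Integrals

variable {d : ℕ}

/-- The bounded continuous functions on `ℝ^d` vanishing near `0`, with explicit constants. -/
structure IsTest (g : EuclideanSpace ℝ (Fin d) → ℝ) (B ε : ℝ) : Prop where
  continuous : Continuous g
  bound : ∀ x, |g x| ≤ B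
  pos : 0 < ε
  vanish : ∀ x, ‖x‖ < ε → g x = 0

theorem IsTest.bound_nonneg {g : EuclideanSpace ℝ (Fin d) → ℝ} {B ε : ℝ} (h : IsTest g B ε) :
    0 ≤ B := (abs_nonneg _).trans (h.bound 0)

/-- The restriction to `ℝ^d` of a function on the punctured space, extended by zero at `0`. -/
noncomputable def restr (f : ExtPunctured d → ℝ) (x : EuclideanSpace ℝ (Fin d)) : ℝ :=
  open Classical in if h : x ≠ 0 then f (finiteIncl d ⟨x, h⟩) else 0

theorem restr_of_ne (f : ExtPunctured d → ℝ) {x : EuclideanSpace ℝ (Fin d)} (h : x ≠ 0) :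
    restr f x = f (finiteIncl d ⟨x, h⟩) := by simp [restr, h]

theorem restr_zero (f : ExtPunctured d → ℝ) : restr f 0 = 0 := by simp [restr]

theorem restr_eq_of_vanish (F : (Fin d → EReal) → ℝ) (h : F 0 = 0)
    (x : EuclideanSpace ℝ (Fin d)) : restr (fun y => F y.1) x = F (coeExt x) := by
  by_cases hx : x = 0
  · rw [hx, restr_zero, coeExt_zero, h]
  · rw [restr_of_ne _ hx]; rfl

/-- The support, being compact in the punctured space, is closed in the whole of `[-∞,∞]^d` and so
misses a neighbourhood of `0`; it may still reach infinity. -/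
theorem exists_isTest_restr (f : C_c(ExtPunctured d, ℝ)) : ∃ B ε, IsTest (restr f) B ε := by
  obtain ⟨B, hB⟩ := f.hasCompactSupport.exists_bound_of_continuous f.continuous
  have hcl : IsClosed (Subtype.val '' tsupport f) :=
    (f.hasCompactSupport.isCompact.image continuous_subtype_val).isClosed
  have h0 : (0 : Fin d → EReal) ∉ Subtype.val '' tsupport f := by
    rintro ⟨x, -, hx⟩
    exact x.2 hx
  have hnhds : ∀ᶠ x in 𝓝 (0 : EuclideanSpace ℝ (Fin d)),
      coeExt x ∈ (Subtype.val '' tsupport f)ᶜ := by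
    refine continuous_coeExt.continuousAt.eventually ?_
    rw [coeExt_zero]
    exact hcl.isOpen_compl.mem_nhds h0
  have hev : ∀ᶠ x in 𝓝 (0 : EuclideanSpace ℝ (Fin d)), restr f x = 0 := by
    filter_upwards [hnhds] with x hx
    by_cases h : x = 0
    · rw [h, restr_zero]
    · rw [restr_of_ne _ h]
      by_contra hne
      exact hx ⟨_, subset_tsupport _ hne, rfl⟩
  obtain ⟨ε, hε, hball⟩ := Metric.eventually_nhds_iff.1 hev
  -- The maximum with `0` covers the origin, where the extension by zero is not controlled by `B`.
  refine ⟨max B 0, ε, ?_, ?_, hε, fun x hx => hball (by simpa using hx)⟩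
  · rw [continuous_iff_continuousAt]
    intro x
    by_cases hx : x = 0
    · subst hx
      exact (continuousAt_const (y := (0 : ℝ))).congr (hev.mono fun _ h => h.symm)
    · have hopen : IsOpen {x : EuclideanSpace ℝ (Fin d) | x ≠ 0} := isOpen_ne
      rw [← hopen.isOpenEmbedding_subtypeVal.continuousAt_iff (x := ⟨x, hx⟩)]
      have : restr f ∘ Subtype.val = fun y => f (finiteIncl d y) := by
        ext y
        exact restr_of_ne _ y.2
      change ContinuousAt (restr f ∘ Subtype.val) (⟨x, hx⟩ : {y : EuclideanSpace ℝ (Fin d) // y ≠ 0})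
      rw [this]
      refine (f.continuous.comp ?_).continuousAt
      exact Continuous.subtype_mk (continuous_coeExt.comp continuous_subtype_val) _
  · intro x
    by_cases hx : x = 0
    · rw [hx, restr_zero]; simp
    · rw [restr_of_ne _ hx]; exact (hB _).trans (le_max_left _ _)

theorem range_finiteIncl : Set.range (finiteIncl d) = (infinitePoints d)ᶜ := by
  ext x
  simp only [Set.mem_range, Set.mem_compl_iff, infinitePoints, Set.mem_ofPred_eq, not_exists, not_or]
  constructor
  · rintro ⟨y, rfl⟩ i
    simp [finiteIncl]
  · intro h
    have hx : ∀ i, ((x.1 i).toReal : EReal) = x.1 i := fun i => EReal.coe_toReal (h i).1 (h i).2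
    refine ⟨⟨WithLp.toLp 2 fun i => (x.1 i).toReal, fun h0 => x.2 ?_⟩, ?_⟩
    · ext i
      rw [← hx i]
      have := congrArg (fun y : EuclideanSpace ℝ (Fin d) => y i) h0
      simp only [PiLp.zero_apply] at this
      simp [this]
    · ext i
      exact hx i

theorem measurableSet_infinitePoints : MeasurableSet (infinitePoints d) := by
  have : infinitePoints d = ⋃ i, (fun x : ExtPunctured d => x.1 i) ⁻¹' {⊤, ⊥} := by
    ext x; simp [infinitePoints]
  rw [this]
  refine MeasurableSet.iUnion fun i => ?_
  exact ((measurable_pi_apply i).comp measurable_subtype_coe)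
    ((Set.toFinite _).measurableSet)

theorem measurableEmbedding_finiteIncl : MeasurableEmbedding (finiteIncl d) := by
  have hinj : Function.Injective (finiteIncl d) := by
    intro x y hxy
    ext i
    have := congrFun (congrArg Subtype.val hxy) i
    simpa [finiteIncl] using this
  refine (Topology.IsEmbedding.measurableEmbedding ?_ ?_)
  · refine ⟨⟨?_⟩, hinj⟩
    have h1 : Topology.IsInducing (fun x : {x : EuclideanSpace ℝ (Fin d) // x ≠ 0} =>
        coeExt x.1) := by
      refine Topology.IsInducing.comp (g := coeExt) ?_ Topology.IsInducing.subtypeVal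
      have h2 : Topology.IsInducing (Pi.map fun (_ : Fin d) (a : ℝ) => (a : EReal)) :=
        Topology.IsInducing.piMap fun _ => EReal.isOpenEmbedding_coe.isInducing
      exact h2.comp (PiLp.homeomorph 2 (fun _ : Fin d => ℝ)).isInducing
    exact (Topology.IsInducing.of_comp (g := Subtype.val)
      (Continuous.subtype_mk (continuous_coeExt.comp continuous_subtype_val) _ :
        Continuous (finiteIncl d)) continuous_subtype_val h1).eq_induced
  · rw [range_finiteIncl]
    exact measurableSet_infinitePoints.compl

theorem measurableSet_ne_zero : MeasurableSet {x : EuclideanSpace ℝ (Fin d) | x ≠ 0} :=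
  (measurableSet_singleton 0).compl

theorem measurableEmbedding_val_ne_zero : MeasurableEmbedding
    (Subtype.val : {x : EuclideanSpace ℝ (Fin d) // x ≠ 0} → EuclideanSpace ℝ (Fin d)) :=
  MeasurableEmbedding.subtype_coe measurableSet_ne_zero

theorem integral_toExt (ν : Measure (EuclideanSpace ℝ (Fin d))) (f : ExtPunctured d → ℝ) :
    ∫ x, f x ∂(toExt ν) = ∫ x, restr f x ∂ν := by
  rw [toExt, measurableEmbedding_finiteIncl.integral_map]
  have h : ∀ x : {x : EuclideanSpace ℝ (Fin d) // x ≠ 0}, f (finiteIncl d x) = restr f x.1 :=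
    fun x => (restr_of_ne f x.2).symm
  simp_rw [h]
  rw [show (∫ x : {x : EuclideanSpace ℝ (Fin d) // x ≠ 0}, restr f x.1
      ∂(ν.comap Subtype.val)) = ∫ x in {x | x ≠ 0}, restr f x ∂ν from
    integral_subtype_comap measurableSet_ne_zero _]
  refine setIntegral_eq_integral_of_forall_compl_eq_zero fun x hx => ?_
  rw [not_not.1 hx, restr_zero]

theorem integrable_toExt (ν : Measure (EuclideanSpace ℝ (Fin d))) (f : ExtPunctured d → ℝ)
    (hf : Integrable (restr f) ν) : Integrable f (toExt ν) := by
  rw [toExt, measurableEmbedding_finiteIncl.integrable_map_iff]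
  have h : f ∘ finiteIncl d = restr f ∘ Subtype.val := by
    ext x
    exact (restr_of_ne f x.2).symm
  rw [h]
  rw [← measurableEmbedding_val_ne_zero.integrable_map_iff,
    measurableEmbedding_val_ne_zero.map_comap]
  exact hf.restrict

theorem integral_finitePart (μ : Measure (ExtPunctured d)) (hμ : μ (infinitePoints d) = 0)
    (g : EuclideanSpace ℝ (Fin d) → ℝ) (f : ExtPunctured d → ℝ)
    (h : ∀ x, g x.1 = f (finiteIncl d x)) : ∫ x, g x ∂(finitePart μ) = ∫ x, f x ∂μ := by
  rw [finitePart, measurableEmbedding_val_ne_zero.integral_map]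
  simp_rw [h]
  rw [← measurableEmbedding_finiteIncl.integral_map (g := f),
    measurableEmbedding_finiteIncl.map_comap, range_finiteIncl]
  rw [Measure.restrict_eq_self_of_ae_mem]
  exact measure_eq_zero_iff_ae_notMem.1 hμ

theorem finitePart_apply (μ : Measure (ExtPunctured d)) {s : Set (EuclideanSpace ℝ (Fin d))}
    (hs : MeasurableSet s) :
    finitePart μ s = μ (finiteIncl d '' (Subtype.val ⁻¹' s)) := by
  rw [finitePart, Measure.map_apply measurable_subtype_coe hs,
    measurableEmbedding_finiteIncl.comap_apply]

theorem finitePart_smul (c : ENNReal) (μ : Measure (ExtPunctured d)) :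
    finitePart (c • μ) = c • finitePart μ := by
  rw [finitePart, finitePart, Measure.comap_smul, Measure.map_smul]

/-- The points of the punctured space whose truncation has norm at least `ε` form a compact set. -/
theorem isCompact_clampExt {R ε : ℝ} (hR : 0 ≤ R) (hε : 0 < ε) :
    IsCompact {x : ExtPunctured d | ε ≤ ‖clampExt R x.1‖} := by
  refine ExtPunctured.isCompact_preimage_val (K := {x | ε ≤ ‖clampExt R x‖})
    (isClosed_le continuous_const (continuous_clampExt R).norm) ?_
  simp [clampExt_zero hR, hε]

/-- The set is unbounded in `ℝ^d`, but once the infinite points are added it lies in a compact set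
avoiding the origin. -/
theorem finitePart_norm_ge_lt_top (μ : Measure (ExtPunctured d)) [IsFiniteMeasureOnCompacts μ]
    {ε : ℝ} (hε : 0 < ε) : finitePart μ {x | ε ≤ ‖x‖} < ⊤ := by
  rw [finitePart_apply _ (measurableSet_le measurable_const measurable_norm)]
  refine lt_of_le_of_lt (measure_mono ?_)
    (isCompact_clampExt (R := ε) hε.le hε).measure_lt_top
  rintro _ ⟨x, hx, rfl⟩
  change ε ≤ ‖clampExt ε (coeExt x.1)‖
  rcases eq_coeExt_clampExt_or_le_norm hε.le (coeExt x.1) with h | h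
  · have : clampExt ε (coeExt x.1) = x.1 := by
      ext i
      have := congrFun h i
      simpa [coeExt] using this
    rw [this]; exact hx
  · exact h

theorem IsTest.integrable_finitePart {g : EuclideanSpace ℝ (Fin d) → ℝ} {B ε : ℝ}
    (hg : IsTest g B ε) (μ : Measure (ExtPunctured d)) [IsFiniteMeasureOnCompacts μ] :
    Integrable g (finitePart μ) := by
  have hm : MeasurableSet {x : EuclideanSpace ℝ (Fin d) | ε ≤ ‖x‖} :=
    measurableSet_le measurable_const measurable_norm
  have h1 : Integrable ({x | ε ≤ ‖x‖}.indicator (fun _ => B)) (finitePart μ) :=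
    (integrable_indicator_iff hm).2
      (integrableOn_const (finitePart_norm_ge_lt_top μ hg.pos).ne)
  refine h1.mono' hg.continuous.aestronglyMeasurable (Eventually.of_forall fun x => ?_)
  by_cases hx : ε ≤ ‖x‖
  · rw [Set.indicator_of_mem (by exact hx)]
    exact hg.bound x
  · rw [Set.indicator_of_notMem (by exact hx), hg.vanish x (not_le.1 hx)]
    simp

end Integrals

/-! ### Test functions and tail-normalised integrals. -/

section Tests

variable {d : ℕ} {g h : EuclideanSpace ℝ (Fin d) → ℝ} {B B' ε ε' : ℝ}

theorem IsTest.sub (hg : IsTest g B ε) (hh : IsTest h B' ε') :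
    IsTest (fun x => g x - h x) (B + B') (min ε ε') where
  continuous := hg.continuous.sub hh.continuous
  bound x := (abs_sub _ _).trans (add_le_add (hg.bound x) (hh.bound x))
  pos := lt_min hg.pos hh.pos
  vanish x hx := by
    rw [hg.vanish x (hx.trans_le (min_le_left _ _)), hh.vanish x (hx.trans_le (min_le_right _ _)),
      sub_zero]

theorem IsTest.const_mul (hg : IsTest g B ε) (c : ℝ) :
    IsTest (fun x => c * g x) (|c| * B) ε where
  continuous := continuous_const.mul hg.continuous
  bound x := by rw [abs_mul]; exact mul_le_mul_of_nonneg_left (hg.bound x) (abs_nonneg _)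
  pos := hg.pos
  vanish x hx := by rw [hg.vanish x hx, mul_zero]

/-- The passage from `ε` to `ε / a` is the source of the factor `a ^ α` in the contraction argument.
-/
theorem IsTest.comp_of_norm_le (hg : IsTest g B ε)
    {A : EuclideanSpace ℝ (Fin d) → EuclideanSpace ℝ (Fin d)} (hA : Continuous A) {a : ℝ}
    (ha : 0 < a) (hn : ∀ x, ‖A x‖ ≤ a * ‖x‖) : IsTest (fun x => g (A x)) B (ε / a) where
  continuous := hg.continuous.comp hA
  bound x := hg.bound _
  pos := div_pos hg.pos ha
  vanish x hx := by
    refine hg.vanish _ ((hn x).trans_lt ?_)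
    rwa [lt_div_iff₀ ha, mul_comm] at hx

theorem IsTest.comp_smul (hg : IsTest g B ε) {t : ℝ} (ht : 0 < t) :
    IsTest (fun x => g (t • x)) B (ε / t) :=
  hg.comp_of_norm_le (continuous_const_smul t) ht fun x => by
    rw [norm_smul, Real.norm_of_nonneg ht.le]

theorem IsTest.integrable_scaled (hg : IsTest g B ε) (ν : Measure (EuclideanSpace ℝ (Fin d)))
    [IsFiniteMeasure ν] (s : ℝ) : Integrable (fun x => g (s⁻¹ • x)) ν :=
  Integrable.of_bound (hg.continuous.comp (continuous_const_smul _)).aestronglyMeasurable B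
    (Eventually.of_forall fun _ => hg.bound _)

/-- The tail function `s ↦ ρ {y | s < ‖y‖}`. -/
noncomputable def tail (ρ : Measure (EuclideanSpace ℝ (Fin d))) (s : ℝ) : ℝ :=
  ρ.real {y | s < ‖y‖}

/-- The integral of `g` against the law of `X / s`, divided by the tail of `ρ`. -/
noncomputable def ratio (ν ρ : Measure (EuclideanSpace ℝ (Fin d)))
    (g : EuclideanSpace ℝ (Fin d) → ℝ) (s : ℝ) : ℝ :=
  (∫ x, g (s⁻¹ • x) ∂ν) / tail ρ s

variable (ν ρ : Measure (EuclideanSpace ℝ (Fin d)))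

theorem integral_scaledRatio (f : C_c(ExtPunctured d, ℝ)) (s : ℝ) :
    ∫ x, f x ∂(scaledRatio ν ρ s) = ratio ν ρ (restr f) s := by
  obtain ⟨B, ε, hf⟩ := exists_isTest_restr f
  rw [scaledRatio, integral_smul_measure, integral_toExt,
    integral_map (by fun_prop) hf.continuous.aestronglyMeasurable, ENNReal.toReal_inv, ratio,
    smul_eq_mul, div_eq_inv_mul, tail, Measure.real]

theorem ratio_const_mul (c : ℝ) (s : ℝ) :
    ratio ν ρ (fun x => c * g x) s = c * ratio ν ρ g s := by
  rw [ratio, ratio, integral_const_mul, mul_div_assoc]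

variable [IsFiniteMeasure ν]

theorem ratio_mono (hg : IsTest g B ε) (hh : IsTest h B' ε') (hle : ∀ x, g x ≤ h x) (s : ℝ) :
    ratio ν ρ g s ≤ ratio ν ρ h s :=
  div_le_div_of_nonneg_right
    (integral_mono (hg.integrable_scaled ν s) (hh.integrable_scaled ν s) fun _ => hle _)
    measureReal_nonneg

theorem ratio_sub (hg : IsTest g B ε) (hh : IsTest h B' ε') (s : ℝ) :
    ratio ν ρ (fun x => g x - h x) s = ratio ν ρ g s - ratio ν ρ h s := by
  rw [ratio, ratio, ratio, integral_sub (hg.integrable_scaled ν s) (hh.integrable_scaled ν s),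
    sub_div]

theorem abs_ratio_le (hg : IsTest g B ε) (hh : IsTest h B' ε') (hle : ∀ x, |g x| ≤ h x) (s : ℝ) :
    |ratio ν ρ g s| ≤ ratio ν ρ h s := by
  rw [abs_le]
  have h1 := ratio_mono ν ρ (hh.const_mul (-1)) hg (fun x => by linarith [(abs_le.1 (hle x)).1]) s
  rw [ratio_const_mul] at h1
  exact ⟨by linarith, ratio_mono ν ρ hg hh (fun x => (abs_le.1 (hle x)).2) s⟩

end Tests

/-! ### Cutoffs at infinity: from compactly supported functions to all test functions. -/

section Cutoff

variable {d : ℕ}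

/-- A continuous step, equal to `0` on `(-∞,1]` and to `1` on `[2,∞)`. -/
noncomputable def step (r : ℝ) : ℝ := max 0 (min 1 (r - 1))

theorem continuous_step : Continuous step := by unfold step; fun_prop

theorem step_nonneg (r : ℝ) : 0 ≤ step r := le_max_left _ _

theorem step_le_one (r : ℝ) : step r ≤ 1 := max_le zero_le_one (min_le_left _ _)

theorem step_of_le {r : ℝ} (h : r ≤ 1) : step r = 0 :=
  max_eq_left ((min_le_right _ _).trans (by linarith))

theorem step_of_ge {r : ℝ} (h : 2 ≤ r) : step r = 1 := by
  rw [step, min_eq_left (by linarith)]; simp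

/-- The cutoff to the neighbourhood of infinity at level `R`. -/
noncomputable def farStep (R : ℝ) (x : Fin d → EReal) : ℝ := step (‖clampExt (2 * R) x‖ / R)

theorem continuous_farStep (R : ℝ) : Continuous (farStep (d := d) R) :=
  continuous_step.comp ((continuous_clampExt _).norm.div_const _)

theorem eventually_norm_clampExt_lt {R ε : ℝ} (hR : 0 ≤ R) (hε : 0 < ε) :
    ∀ᶠ x in 𝓝 (0 : Fin d → EReal), ‖clampExt R x‖ < ε := by
  have := (continuous_clampExt (d := d) R).norm.tendsto 0
  rw [clampExt_zero hR, norm_zero] at this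
  exact this.eventually (gt_mem_nhds hε)

theorem farStep_nonneg (R : ℝ) (x : Fin d → EReal) : 0 ≤ farStep R x := step_nonneg _

theorem farStep_le_one (R : ℝ) (x : Fin d → EReal) : farStep R x ≤ 1 := step_le_one _

theorem farStep_eventually_zero {R : ℝ} (hR : 0 < R) :
    ∀ᶠ x in 𝓝 (0 : Fin d → EReal), farStep R x = 0 := by
  filter_upwards [eventually_norm_clampExt_lt (d := d) (R := 2 * R) (by linarith) hR] with x hx
  exact step_of_le ((div_le_one hR).2 hx.le)

/-- The cutoff near infinity as a compactly supported function on the punctured space. -/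
noncomputable def farCutoff {R : ℝ} (hR : 0 < R) : C_c(ExtPunctured d, ℝ) :=
  ofVanishing (farStep R) (continuous_farStep R) (farStep_eventually_zero hR)

theorem restr_farCutoff {R : ℝ} (hR : 0 < R) (x : EuclideanSpace ℝ (Fin d)) :
    restr (farCutoff hR) x = farStep R (coeExt x) :=
  restr_eq_of_vanish _ (farStep_eventually_zero hR).self_of_nhds x

theorem isTest_farCutoff {R : ℝ} (hR : 0 < R) :
    IsTest (restr (farCutoff (d := d) hR)) 1 R := by
  obtain ⟨_, _, h⟩ := exists_isTest_restr (farCutoff (d := d) hR)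
  refine ⟨h.continuous, fun x => ?_, hR, fun x hx => ?_⟩
  · rw [restr_farCutoff, abs_of_nonneg (farStep_nonneg _ _)]; exact farStep_le_one _ _
  · rw [restr_farCutoff]
    refine step_of_le ((div_le_one hR).2 ?_)
    exact (norm_clampExt_coeExt_le _ (by linarith) x).trans hx.le

/-- A test function need not have limits at infinity, so it may fail to extend continuously to the
compactification. Composing with truncation at level `2 * R` changes it only at points where
`farStep R` is `1` and the product vanishes anyway. -/
theorem exists_cutoff {g : EuclideanSpace ℝ (Fin d) → ℝ} {B ε : ℝ} (hg : IsTest g B ε) {R : ℝ}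
    (hR : 0 < R) : ∃ G : C_c(ExtPunctured d, ℝ),
      ∀ x, restr G x = g x * (1 - restr (farCutoff hR) x) := by
  have h0 : ∀ᶠ x in 𝓝 (0 : Fin d → EReal), g (clampExt (2 * R) x) * (1 - farStep R x) = 0 := by
    filter_upwards [eventually_norm_clampExt_lt (d := d) (R := 2 * R) (by linarith) hg.pos]
      with x hx
    rw [hg.vanish _ hx, zero_mul]
  refine ⟨ofVanishing _ ((hg.continuous.comp (continuous_clampExt _)).mul
    (continuous_const.sub (continuous_farStep R))) h0, fun x => ?_⟩
  rw [restr_farCutoff]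
  refine (restr_eq_of_vanish (fun y => g (clampExt (2 * R) y) * (1 - farStep R y))
    h0.self_of_nhds x).trans ?_
  rcases eq_coeExt_clampExt_or_le_norm (R := 2 * R) (by linarith) (coeExt x) with h | h
  · have : clampExt (2 * R) (coeExt x) = x := by
      ext i
      simpa [coeExt] using congrFun h i
    rw [this]
  · have : farStep R (coeExt x) = 1 := step_of_ge ((le_div_iff₀ hR).2 h)
    rw [this]; simp

/-- Dominated convergence: one compact set carries all the cutoffs, and at each finite point they
are eventually zero. -/
theorem tendsto_integral_farCutoff (μ : Measure (ExtPunctured d)) [IsFiniteMeasureOnCompacts μ]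
    (hμ : μ (infinitePoints d) = 0) :
    Tendsto (fun n : ℕ => ∫ x : ExtPunctured d, farStep ((n : ℝ) + 1) x.1 ∂μ) atTop (𝓝 0) := by
  have hc := isCompact_clampExt (d := d) (R := 1) (ε := 1) zero_le_one zero_lt_one
  rw [show (0 : ℝ) = ∫ x : ExtPunctured d, 0 ∂μ by simp]
  refine tendsto_integral_of_dominated_convergence
    ({x : ExtPunctured d | 1 ≤ ‖clampExt 1 x.1‖}.indicator fun _ => (1 : ℝ))
    (fun n => ((continuous_farStep _).comp continuous_subtype_val).aestronglyMeasurable)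
    ((integrable_indicator_iff hc.measurableSet).2 (integrableOn_const hc.measure_lt_top.ne))
    (fun n => Eventually.of_forall fun x => ?_) ?_
  · rw [Real.norm_of_nonneg (farStep_nonneg _ _)]
    by_cases hx : 1 ≤ ‖clampExt 1 x.1‖
    · rw [Set.indicator_of_mem (by exact hx)]; exact step_le_one _
    · rw [Set.indicator_of_notMem (by exact hx)]
      have hn : (0 : ℝ) ≤ n := n.cast_nonneg
      refine (step_of_le ?_).le
      rw [clampExt_eq_of_norm_lt zero_le_one (by linarith) (not_le.1 hx), div_le_one (by linarith)]
      linarith [not_le.1 hx]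
  · filter_upwards [measure_eq_zero_iff_ae_notMem.1 hμ] with x hx
    obtain ⟨y, rfl⟩ : x ∈ Set.range (finiteIncl d) := by rw [range_finiteIncl]; exact hx
    refine tendsto_const_nhds.congr' ?_
    filter_upwards [eventually_ge_atTop ⌈‖y.1‖⌉₊] with n hn
    have hn' : ‖y.1‖ ≤ n := (Nat.le_ceil _).trans (by exact_mod_cast hn)
    have h0 : (0 : ℝ) ≤ n := n.cast_nonneg
    refine (step_of_le ?_).symm
    change ‖clampExt _ (coeExt y.1)‖ / _ ≤ 1
    rw [div_le_one (by linarith)]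
    exact (norm_clampExt_coeExt_le _ (by linarith) _).trans (by linarith)

/-- Vague convergence to a measure not charging the infinite points extends to all bounded
continuous functions on `ℝ^d` vanishing near `0`. -/
theorem tendsto_ratio_of_restr (ν ρ : Measure (EuclideanSpace ℝ (Fin d))) [IsFiniteMeasure ν]
    (μ : Measure (ExtPunctured d)) [IsFiniteMeasureOnCompacts μ] (hμ : μ (infinitePoints d) = 0)
    (h : ∀ f : C_c(ExtPunctured d, ℝ), Tendsto (ratio ν ρ (restr f)) atTop (𝓝 (∫ x, f x ∂μ)))
    {g : EuclideanSpace ℝ (Fin d) → ℝ} {B ε : ℝ} (hg : IsTest g B ε) :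
    Tendsto (ratio ν ρ g) atTop (𝓝 (∫ x, g x ∂(finitePart μ))) := by
  have hB := hg.bound_nonneg
  rw [Metric.tendsto_atTop']
  intro δ hδ
  -- Three errors of at most `δ / 4` arise: cutting `g` off before the limit, cutting it off in the
  -- limit, and the convergence for the cut-off function. The denominator uses `B + 1` because `B`
  -- may be `0`.
  have hsmall := (tendsto_integral_farCutoff μ hμ).eventually
    (gt_mem_nhds (show 0 < δ / (4 * (B + 1)) by positivity))
  obtain ⟨n, hn⟩ := hsmall.exists
  have hR : (0 : ℝ) < (n : ℝ) + 1 := by positivity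
  set F : C_c(ExtPunctured d, ℝ) := farCutoff hR with hF
  have hFn : ∫ x, F x ∂μ < δ / (4 * (B + 1)) := hn
  have hFt : IsTest (restr F) 1 (n + 1) := isTest_farCutoff hR
  obtain ⟨G, hG⟩ := exists_cutoff hg hR
  obtain ⟨_, _, hGt⟩ := exists_isTest_restr G
  have hFnn : ∀ x, 0 ≤ restr F x := fun x => by
    rw [hF, restr_farCutoff]; exact step_nonneg _
  have hdiff : ∀ x, |g x - restr G x| ≤ B * restr F x := fun x => by
    rw [hG, show g x - g x * (1 - restr F x) = g x * restr F x by ring, abs_mul,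
      abs_of_nonneg (hFnn x)]
    exact mul_le_mul_of_nonneg_right (hg.bound x) (hFnn x)
  have h1 : ∀ s, |ratio ν ρ g s - ratio ν ρ (restr G) s| ≤ B * ratio ν ρ (restr F) s := fun s => by
    rw [← ratio_sub ν ρ hg hGt, ← ratio_const_mul]
    exact abs_ratio_le ν ρ (hg.sub hGt) (hFt.const_mul B) hdiff s
  have hfin : ∀ f : C_c(ExtPunctured d, ℝ), ∫ x, restr f x ∂(finitePart μ) = ∫ x, f x ∂μ :=
    fun f => integral_finitePart μ hμ _ _ fun x => restr_of_ne f x.2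
  have h2 : |∫ x, g x ∂(finitePart μ) - ∫ x, G x ∂μ| ≤ B * ∫ x, F x ∂μ := by
    rw [← hfin, ← hfin, ← integral_sub (hg.integrable_finitePart μ) (hGt.integrable_finitePart μ),
      ← integral_const_mul]
    refine abs_integral_le_integral_abs.trans ?_
    exact integral_mono ((hg.sub hGt).integrable_finitePart μ).abs
      ((hFt.const_mul B).integrable_finitePart μ) hdiff
  have hBF : B * (δ / (4 * (B + 1))) ≤ δ / 4 := by
    rw [← mul_div_assoc, div_le_div_iff₀ (by positivity) (by norm_num)]
    nlinarith
  have hev : ∀ᶠ s in atTop, ratio ν ρ (restr F) s < δ / (4 * (B + 1)) :=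
    (h F).eventually (gt_mem_nhds hFn)
  have hevG : ∀ᶠ s in atTop, |ratio ν ρ (restr G) s - ∫ x, G x ∂μ| < δ / 4 := by
    have := (h G).eventually (Metric.ball_mem_nhds _ (show 0 < δ / 4 by positivity))
    simpa [Real.dist_eq] using this
  obtain ⟨s₀, hs₀⟩ := eventually_atTop.1 (hev.and hevG)
  refine ⟨s₀, fun s hs => ?_⟩
  obtain ⟨e1, e2⟩ := hs₀ s hs.le
  rw [Real.dist_eq]
  have e3 := (h1 s).trans ((mul_le_mul_of_nonneg_left e1.le hB).trans hBF)
  have e4 := h2.trans ((mul_le_mul_of_nonneg_left hFn.le hB).trans hBF)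
  rw [abs_le] at e3 e4
  rw [abs_lt] at e2 ⊢
  constructor <;> linarith

end Cutoff

/-! ### Dilations and homogeneity. -/

section Dilation

variable {d : ℕ}

theorem continuous_ereal_const_mul (t : ℝ) :
    Continuous fun a : EReal => (t : EReal) * a := by
  rw [continuous_iff_continuousAt]
  intro a
  refine EReal.Tendsto.const_mul tendsto_id (Or.inl ?_) (Or.inl ?_)
  all_goals simp

/-- The dilation by `t > 0` of the punctured space. -/
noncomputable def dilation (d : ℕ) {t : ℝ} (ht : 0 < t) : ExtPunctured d ≃ₜ ExtPunctured d where
  toFun x := ⟨fun i => (t : EReal) * x.1 i, fun h => x.2 (by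
    ext i
    have := congrFun h i
    simpa [ht.ne'] using this)⟩
  invFun x := ⟨fun i => ((t⁻¹ : ℝ) : EReal) * x.1 i, fun h => x.2 (by
    ext i
    have := congrFun h i
    simpa [ht.ne'] using this)⟩
  left_inv x := by
    ext i
    simp only
    rw [← mul_assoc, ← EReal.coe_mul, inv_mul_cancel₀ ht.ne', EReal.coe_one, one_mul]
  right_inv x := by
    ext i
    simp only
    rw [← mul_assoc, ← EReal.coe_mul, mul_inv_cancel₀ ht.ne', EReal.coe_one, one_mul]
  continuous_toFun := Continuous.subtype_mk (continuous_pi fun i =>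
    (continuous_ereal_const_mul t).comp ((continuous_apply i).comp continuous_subtype_val)) _
  continuous_invFun := Continuous.subtype_mk (continuous_pi fun i =>
    (continuous_ereal_const_mul t⁻¹).comp
      ((continuous_apply i).comp continuous_subtype_val)) _

theorem dilate_eq_preimage {t : ℝ} (ht : 0 < t) (A : Set (ExtPunctured d)) :
    dilate t A = dilation d (inv_pos.2 ht) ⁻¹' A := by
  ext x
  constructor
  · rintro ⟨a, ha, hxa⟩
    have : dilation d (inv_pos.2 ht) x = a := by
      ext i
      change ((t⁻¹ : ℝ) : EReal) * x.1 i = a.1 i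
      rw [hxa i, ← mul_assoc, ← EReal.coe_mul, inv_mul_cancel₀ ht.ne', EReal.coe_one, one_mul]
    rw [Set.mem_preimage, this]
    exact ha
  · intro hx
    refine ⟨_, hx, fun i => ?_⟩
    change x.1 i = (t : EReal) * (((t⁻¹ : ℝ) : EReal) * x.1 i)
    rw [← mul_assoc, ← EReal.coe_mul, mul_inv_cancel₀ ht.ne', EReal.coe_one, one_mul]

/-- The composition of a compactly supported function with a dilation. -/
noncomputable def compDilation (f : C_c(ExtPunctured d, ℝ)) {t : ℝ} (ht : 0 < t) :
    C_c(ExtPunctured d, ℝ) where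
  toFun x := f (dilation d ht x)
  continuous_toFun := f.continuous.comp (dilation d ht).continuous
  hasCompactSupport' := f.hasCompactSupport.comp_homeomorph (dilation d ht)

theorem restr_compDilation (f : C_c(ExtPunctured d, ℝ)) {t : ℝ} (ht : 0 < t)
    (x : EuclideanSpace ℝ (Fin d)) : restr (compDilation f ht) x = restr f (t • x) := by
  by_cases hx : x = 0
  · rw [hx, smul_zero, restr_zero, restr_zero]
  · rw [restr_of_ne _ hx, restr_of_ne f (smul_ne_zero ht.ne' hx)]
    change f _ = f _
    congr 1

/-- Homogeneity on Borel sets in terms of image measures. -/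
theorem homogeneous_iff_map_dilation (μ : Measure (ExtPunctured d)) (α : ℝ) :
    (∀ t : ℝ, 0 < t → ∀ A : Set (ExtPunctured d), MeasurableSet A →
      μ (dilate t A) = ENNReal.ofReal (t ^ (-α)) * μ A) ↔
    ∀ (t : ℝ) (ht : 0 < t), μ.map (dilation d ht) = ENNReal.ofReal (t ^ α) • μ := by
  constructor
  · intro h t ht
    ext A hA
    have h1 := h t⁻¹ (inv_pos.2 ht) A hA
    rw [dilate_eq_preimage (inv_pos.2 ht)] at h1
    simp only [inv_inv] at h1
    rw [Measure.map_apply (dilation d ht).continuous.measurable hA, h1, Measure.smul_apply,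
      Real.inv_rpow ht.le, Real.rpow_neg ht.le, inv_inv, smul_eq_mul]
  · intro h t ht A hA
    have h1 := h t⁻¹ (inv_pos.2 ht)
    rw [dilate_eq_preimage ht, ← Measure.map_apply (dilation d _).continuous.measurable hA, h1,
      Measure.smul_apply, Real.inv_rpow ht.le, Real.rpow_neg ht.le, smul_eq_mul]

theorem integral_compDilation (μ : Measure (ExtPunctured d)) (α : ℝ)
    (h : ∀ t : ℝ, 0 < t → ∀ A : Set (ExtPunctured d), MeasurableSet A →
      μ (dilate t A) = ENNReal.ofReal (t ^ (-α)) * μ A)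
    (f : C_c(ExtPunctured d, ℝ)) {t : ℝ} (ht : 0 < t) :
    ∫ x, compDilation f ht x ∂μ = t ^ α * ∫ x, f x ∂μ := by
  have h1 := (homogeneous_iff_map_dilation μ α).1 h t ht
  have h2 := (dilation d ht).measurableEmbedding.integral_map (μ := μ) (fun x => f x)
  rw [h1, integral_smul_measure, ENNReal.toReal_ofReal (by positivity)] at h2
  exact h2.symm

/-- The image of `μ` under the dilation and the multiple of `μ` are both regular, so agreement on
compactly supported functions suffices. -/
theorem homogeneous_of_integral_compDilation (μ : Measure (ExtPunctured d))
    [IsFiniteMeasureOnCompacts μ] (α : ℝ)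
    (h : ∀ (f : C_c(ExtPunctured d, ℝ)) (t : ℝ) (ht : 0 < t),
      ∫ x, compDilation f ht x ∂μ = t ^ α * ∫ x, f x ∂μ) :
    ∀ t : ℝ, 0 < t → ∀ A : Set (ExtPunctured d), MeasurableSet A →
      μ (dilate t A) = ENNReal.ofReal (t ^ (-α)) * μ A := by
  rw [homogeneous_iff_map_dilation]
  intro t ht
  have := ExtPunctured.regular_of_isFiniteMeasureOnCompacts μ
  have : (μ.map (dilation d ht)).Regular := Measure.Regular.map (dilation d ht)
  have : (ENNReal.ofReal (t ^ α) • μ).Regular := Measure.Regular.smul ENNReal.ofReal_ne_top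
  refine Measure.ext_of_integral_eq_on_compactlySupported fun f => ?_
  rw [(dilation d ht).measurableEmbedding.integral_map, integral_smul_measure,
    ENNReal.toReal_ofReal (by positivity)]
  exact h f t ht

end Dilation

/-! ### Regular variation of the tail of X and domination of the tail of a summand. -/

section Tail

variable {d : ℕ}

theorem tail_nonneg (ρ : Measure (EuclideanSpace ℝ (Fin d))) (s : ℝ) : 0 ≤ tail ρ s :=
  measureReal_nonneg

theorem measurableSet_lt_norm (s : ℝ) :
    MeasurableSet {y : EuclideanSpace ℝ (Fin d) | s < ‖y‖} :=
  measurableSet_lt measurable_const measurable_norm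

theorem tail_antitone (ρ : Measure (EuclideanSpace ℝ (Fin d))) [IsFiniteMeasure ρ] :
    Antitone (tail ρ) := fun _ _ hst =>
  measureReal_mono fun _ hy => lt_of_le_of_lt hst hy

theorem tendsto_tail_atTop (ρ : Measure (EuclideanSpace ℝ (Fin d))) [IsFiniteMeasure ρ] :
    Tendsto (tail ρ) atTop (𝓝 0) := by
  have h := tendsto_measure_norm_gt_of_isTightMeasureSet
    (isTightMeasureSet_singleton (μ := ρ))
  simp only [Set.mem_singleton_iff, iSup_iSup_eq_left] at h
  exact (ENNReal.tendsto_toReal ENNReal.zero_ne_top).comp h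

/-- Scaling the test function amounts to scaling `s`, at the price of a quotient of tails. Read one
way this derives regular variation of the tail from homogeneity of the limit, read the other way the
converse. -/
theorem ratio_comp_smul (ν ρ : Measure (EuclideanSpace ℝ (Fin d)))
    (g : EuclideanSpace ℝ (Fin d) → ℝ) {u s : ℝ} (h : tail ρ (u * s) ≠ 0) :
    ratio ν ρ (fun x => g (u⁻¹ • x)) s = ratio ν ρ g (u * s) * (tail ρ (u * s) / tail ρ s) := by
  simp only [ratio, smul_smul, mul_inv]
  field_simp

/-- If the scaled ratios converge at a test function and at its dilation, with a nonzero limit,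
then the tail ratio converges. -/
theorem tendsto_tail_div (ν ρ : Measure (EuclideanSpace ℝ (Fin d)))
    (hρ : ∀ s, 0 < tail ρ s) {g : EuclideanSpace ℝ (Fin d) → ℝ} {u c l : ℝ} (hu : 0 < u)
    (hl : l ≠ 0) (h1 : Tendsto (ratio ν ρ g) atTop (𝓝 l))
    (h2 : Tendsto (ratio ν ρ fun x => g (u⁻¹ • x)) atTop (𝓝 (c * l))) :
    Tendsto (fun s => tail ρ (u * s) / tail ρ s) atTop (𝓝 c) := by
  have h3 : Tendsto (fun s => ratio ν ρ g (u * s)) atTop (𝓝 l) :=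
    h1.comp (tendsto_id.const_mul_atTop hu)
  have h4 := h2.div h3 hl
  rw [mul_div_cancel_right₀ _ hl] at h4
  refine h4.congr' ?_
  filter_upwards [h3.eventually_ne hl] with s hs
  simp only [Pi.div_apply]
  rw [ratio_comp_smul ν ρ g (hρ _).ne', mul_div_cancel_left₀ _ hs]

theorem IsRegularlyVarying.exists_integral_ne_zero {ν : Measure (EuclideanSpace ℝ (Fin d))}
    {α : ℝ} {μ : Measure (ExtPunctured d)} (h : IsRegularlyVarying ν α μ) :
    ∃ f : C_c(ExtPunctured d, ℝ), ∫ x, f x ∂μ ≠ 0 := by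
  by_contra! hcon
  have := h.radon
  have := ExtPunctured.regular_of_isFiniteMeasureOnCompacts μ
  exact h.ne_zero (Measure.ext_of_integral_eq_on_compactlySupported fun f => by simp [hcon f])

theorem IsRegularlyVarying.tendsto_ratio_restr {ν : Measure (EuclideanSpace ℝ (Fin d))}
    {α : ℝ} {μ : Measure (ExtPunctured d)} (h : IsRegularlyVarying ν α μ)
    (f : C_c(ExtPunctured d, ℝ)) :
    Tendsto (ratio ν ν (restr f)) atTop (𝓝 (∫ x, f x ∂μ)) :=
  (h.tendsto f).congr fun s => integral_scaledRatio ν ν f s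

/-- A tail vanishing once vanishes from there on; division by zero being zero, all ratios would tend
to `0`, contradicting that the tail measure is non-null. -/
theorem IsRegularlyVarying.tail_pos {ν : Measure (EuclideanSpace ℝ (Fin d))} [IsFiniteMeasure ν]
    {α : ℝ} {μ : Measure (ExtPunctured d)} (h : IsRegularlyVarying ν α μ) (s : ℝ) :
    0 < tail ν s := by
  by_contra hs
  obtain ⟨f, hf⟩ := h.exists_integral_ne_zero
  refine hf (tendsto_nhds_unique (h.tendsto_ratio_restr f) (tendsto_const_nhds.congr' ?_))
  filter_upwards [eventually_ge_atTop s] with r hr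
  have : tail ν r = 0 :=
    le_antisymm ((tail_antitone ν hr).trans (not_lt.1 hs)) (tail_nonneg ν r)
  rw [ratio, this, div_zero]

theorem IsRegularlyVarying.tendsto_tail_div {ν : Measure (EuclideanSpace ℝ (Fin d))}
    [IsFiniteMeasure ν] {α : ℝ} {μ : Measure (ExtPunctured d)} (h : IsRegularlyVarying ν α μ)
    {u : ℝ} (hu : 0 < u) :
    Tendsto (fun s => tail ν (u * s) / tail ν s) atTop (𝓝 (u ^ (-α))) := by
  obtain ⟨f, hf⟩ := h.exists_integral_ne_zero
  refine _root_.tendsto_tail_div ν ν h.tail_pos hu hf (h.tendsto_ratio_restr f) ?_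
  have h2 := h.tendsto_ratio_restr (compDilation f (inv_pos.2 hu))
  rw [integral_compDilation μ α h.homogeneous, Real.inv_rpow hu.le, ← Real.rpow_neg hu.le] at h2
  refine h2.congr fun s => ?_
  simp only [ratio, restr_compDilation]

theorem tail_map {Ω : Type*} [MeasurableSpace Ω] (P : Measure Ω)
    {Y : Ω → EuclideanSpace ℝ (Fin d)} (hY : AEMeasurable Y P) (s : ℝ) :
    tail (P.map Y) s = P.real {ω | s < ‖Y ω‖} :=
  map_measureReal_apply_of_aemeasurable hY (measurableSet_lt_norm s)

/-- The tail of an independent summand is bounded by the tail of the sum. -/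
theorem eventually_tail_summand_le {Ω : Type*} [MeasurableSpace Ω] (P : Measure Ω)
    [IsProbabilityMeasure P] {X Y W : Ω → EuclideanSpace ℝ (Fin d)} (hX : AEMeasurable X P)
    (hY : AEMeasurable Y P) (hW : AEMeasurable W P) (hYW : IndepFun Y W P)
    (A : EuclideanSpace ℝ (Fin d) → EuclideanSpace ℝ (Fin d)) {γ : ℝ} (hγ : 0 < γ)
    (hA : ∀ z, γ * ‖z‖ ≤ ‖A z‖) (hXYW : ∀ ω, X ω = A (Y ω) + W ω) {α : ℝ}
    (hpos : ∀ s, 0 < tail (P.map X) s)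
    (hlim : ∀ u : ℝ, 0 < u →
      Tendsto (fun s => tail (P.map X) (u * s) / tail (P.map X) s) atTop (𝓝 (u ^ (-α))))
    {u : ℝ} (hu : 0 < u) :
    ∀ᶠ s in atTop, tail (P.map Y) (u * s) ≤
      4 * (γ / 2) ^ (-α) * u ^ (-α) * tail (P.map X) s := by
  have := Measure.isProbabilityMeasure_map hW
  obtain ⟨n, hn⟩ := ((tendsto_tail_atTop (P.map W)).eventually
    (gt_mem_nhds (show (0 : ℝ) < 1 / 2 by norm_num))).exists
  -- Half of the lower bound `γ * (u * s)` for `‖A (Y ω)‖` is kept for `X`, the other half absorbs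
  -- `‖W ω‖ ≤ n` as soon as `n ≤ v * s`.
  set v := γ / 2 * u with hv
  have hv0 : 0 < v := by positivity
  have hc : (0 : ℝ) < v ^ (-α) := by positivity
  -- This slack of `2`, times the `2` lost because `‖W‖ ≤ n` has probability at least `1 / 2`, gives
  -- the constant `4`.
  have hev := (hlim v hv0).eventually (gt_mem_nhds (show v ^ (-α) < 2 * v ^ (-α) by linarith))
  filter_upwards [hev, eventually_ge_atTop (n / v)] with s hs hns
  rw [div_lt_iff₀ (hpos s)] at hs
  rw [div_le_iff₀ hv0] at hns
  have hmul : v ^ (-α) = (γ / 2) ^ (-α) * u ^ (-α) := Real.mul_rpow (by positivity) hu.le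
  have hWn : (1 : ℝ) / 2 ≤ P.real (W ⁻¹' {y | n < ‖y‖}ᶜ) := by
    have h1 : tail (P.map W) n = 1 - (P.map W).real {y | n < ‖y‖}ᶜ := by
      rw [tail, probReal_compl_eq_one_sub (measurableSet_lt_norm n)]; ring
    rw [← map_measureReal_apply_of_aemeasurable hW (measurableSet_lt_norm n).compl]
    linarith
  have hind := hYW.measure_inter_preimage_eq_mul {y | u * s < ‖y‖} {y | n < ‖y‖}ᶜ
    (measurableSet_lt_norm _) (measurableSet_lt_norm n).compl
  have hind' : P.real (Y ⁻¹' {y | u * s < ‖y‖} ∩ W ⁻¹' {y | n < ‖y‖}ᶜ) =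
      P.real (Y ⁻¹' {y | u * s < ‖y‖}) * P.real (W ⁻¹' {y | n < ‖y‖}ᶜ) := by
    simp only [Measure.real, hind, ENNReal.toReal_mul]
  have hsub : Y ⁻¹' {y | u * s < ‖y‖} ∩ W ⁻¹' {y | n < ‖y‖}ᶜ ⊆ {ω | v * s < ‖X ω‖} := by
    rintro ω ⟨h1, h2⟩
    have h1 : u * s < ‖Y ω‖ := h1
    have h2 : ‖W ω‖ ≤ n := not_lt.1 h2
    change v * s < ‖X ω‖
    have h3 : ‖A (Y ω)‖ ≤ ‖X ω‖ + ‖W ω‖ := by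
      rw [show A (Y ω) = X ω - W ω by rw [hXYW ω]; abel]
      exact norm_sub_le _ _
    have h4 := hA (Y ω)
    have h5 : γ * (u * s) < γ * ‖Y ω‖ := by gcongr
    have h6 : γ * (u * s) = 2 * (v * s) := by rw [hv]; ring
    linarith
  have h7 := measureReal_mono (μ := P) hsub
  rw [hind', ← tail_map P hX] at h7
  rw [tail_map P hY]
  have h8 : (0 : ℝ) ≤ P.real {ω | u * s < ‖Y ω‖} := measureReal_nonneg
  have h9 : P.real {ω | u * s < ‖Y ω‖} * (1 / 2) ≤ tail (P.map X) (v * s) :=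
    (mul_le_mul_of_nonneg_left hWn h8).trans h7
  rw [hmul] at hs
  linarith

/-- A power bound for the tail gives a bound for the scaled integrals of test functions. -/
theorem eventually_abs_ratio_le (ζ : Measure (EuclideanSpace ℝ (Fin d))) [IsFiniteMeasure ζ]
    (ν : Measure (EuclideanSpace ℝ (Fin d))) (hν : ∀ s, 0 < tail ν s) {C α : ℝ}
    (htail : ∀ u : ℝ, 0 < u → ∀ᶠ s in atTop, tail ζ (u * s) ≤ C * u ^ (-α) * tail ν s)
    {g : EuclideanSpace ℝ (Fin d) → ℝ} {B ε : ℝ} (hg : IsTest g B ε) :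
    ∀ᶠ s in atTop, |ratio ζ ν g s| ≤ C * (1 / 2) ^ (-α) * (B * ε ^ (-α)) := by
  have hε := hg.pos
  -- The radius is halved since `g` may be nonzero on the sphere of radius `ε`, which the strict
  -- inequality in the tail would miss.
  filter_upwards [htail (1 / 2 * ε) (by positivity), eventually_gt_atTop 0] with s hs hs0
  rw [ratio, abs_div, abs_of_pos (hν s), div_le_iff₀ (hν s)]
  have hm := measurableSet_lt_norm (d := d) (1 / 2 * ε * s)
  have h1 : |∫ x, g (s⁻¹ • x) ∂ζ| ≤ B * tail ζ (1 / 2 * ε * s) := by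
    have h2 : ∫ x, ({y | 1 / 2 * ε * s < ‖y‖}.indicator (fun _ => B)) x ∂ζ =
        B * tail ζ (1 / 2 * ε * s) := by
      rw [integral_indicator hm, setIntegral_const, smul_eq_mul, mul_comm, tail]
    rw [← h2]
    refine abs_integral_le_integral_abs.trans (integral_mono (hg.integrable_scaled ζ s).abs
      ((integrable_const B).indicator hm) fun x => ?_)
    by_cases hx : 1 / 2 * ε * s < ‖x‖
    · rw [Set.indicator_of_mem (by exact hx)]; exact hg.bound _
    · rw [Set.indicator_of_notMem (by exact hx)]
      have : g (s⁻¹ • x) = 0 := by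
        refine hg.vanish _ ?_
        rw [norm_smul, norm_inv, Real.norm_of_nonneg hs0.le, inv_mul_lt_iff₀ hs0]
        have := mul_pos hε hs0
        linarith [not_lt.1 hx]
      simp [this]
  refine h1.trans ((mul_le_mul_of_nonneg_left hs hg.bound_nonneg).trans (le_of_eq ?_))
  rw [Real.mul_rpow (by norm_num) hε.le]
  ring

end Tail

/-! ### The principle of a single big jump. -/

section SingleBigJump

variable {d q : ℕ}

/-- The indicator of `{x | r < ‖x‖}`. -/
noncomputable def far (r : ℝ) (x : EuclideanSpace ℝ (Fin d)) : ℝ :=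
  {y : EuclideanSpace ℝ (Fin d) | r < ‖y‖}.indicator (fun _ => 1) x

theorem far_nonneg (r : ℝ) (x : EuclideanSpace ℝ (Fin d)) : 0 ≤ far r x :=
  Set.indicator_nonneg (fun _ _ => zero_le_one) x

theorem far_le_one (r : ℝ) (x : EuclideanSpace ℝ (Fin d)) : far r x ≤ 1 :=
  Set.indicator_le_self' (fun _ _ => zero_le_one) x

theorem far_of_lt {r : ℝ} {x : EuclideanSpace ℝ (Fin d)} (h : r < ‖x‖) : far r x = 1 :=
  Set.indicator_of_mem (by exact h) _

theorem measurable_far (r : ℝ) : Measurable (far (d := d) r) :=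
  measurable_const.indicator (measurableSet_lt_norm r)

/-- Deterministic comparison of `g (∑ y j)` and `∑ g (y j)`. -/
theorem IsTest.abs_sub_sum_le [NeZero q] {g : EuclideanSpace ℝ (Fin d) → ℝ} {B ε : ℝ}
    (hg : IsTest g B ε) {δ R η : ℝ} (hδ : 0 ≤ δ) (hη : 0 < η) (hqη : q * η ≤ ε / 2)
    (huc : ∀ x y, ‖x‖ ≤ R → ‖y - x‖ ≤ q * η → |g y - g x| ≤ δ)
    (y : Fin q → EuclideanSpace ℝ (Fin d)) :
    |g (∑ j, y j) - ∑ j, g (y j)| ≤ δ * ∑ j, far (ε / 4) (y j) + 2 * B * ∑ j, far R (y j) +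
      (q + 1) * B * ∑ i, ∑ j ∈ Finset.univ.erase i, far η (y i) * far η (y j) := by
  have hB := hg.bound_nonneg
  have hε := hg.pos
  have hS1 : 0 ≤ ∑ j, far (ε / 4) (y j) := Finset.sum_nonneg fun j _ => far_nonneg _ _
  have hS2 : 0 ≤ ∑ j, far R (y j) := Finset.sum_nonneg fun j _ => far_nonneg _ _
  have hS3i : ∀ i, 0 ≤ ∑ j ∈ Finset.univ.erase i, far η (y i) * far η (y j) := fun i =>
    Finset.sum_nonneg fun j _ => mul_nonneg (far_nonneg _ _) (far_nonneg _ _)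
  have hS3 := Finset.sum_nonneg fun i (_ : i ∈ (Finset.univ : Finset (Fin q))) => hS3i i
  have hq : (1 : ℝ) ≤ q := by exact_mod_cast NeZero.one_le
  -- Two large terms: the crude bound `(q + 1) * B` is paid by the double sum. Otherwise all terms
  -- but one, `y i`, have norm at most `η`; `g` vanishes at those, and the whole sum lies within `q
  -- * η` of `y i`.
  by_cases hcase : ∃ i j, i ≠ j ∧ η < ‖y i‖ ∧ η < ‖y j‖
  · obtain ⟨i, j, hij, hi, hj⟩ := hcase
    have h1 : 1 ≤ ∑ i, ∑ j ∈ Finset.univ.erase i, far η (y i) * far η (y j) := by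
      refine le_trans ?_ (Finset.single_le_sum (fun i _ => hS3i i) (Finset.mem_univ i))
      refine le_trans ?_ (Finset.single_le_sum
        (fun j _ => mul_nonneg (far_nonneg _ _) (far_nonneg _ _))
        (Finset.mem_erase.2 ⟨hij.symm, Finset.mem_univ j⟩))
      rw [far_of_lt hi, far_of_lt hj, one_mul]
    have h2 : |∑ j, g (y j)| ≤ q * B := by
      refine (Finset.abs_sum_le_sum_abs _ _).trans
        ((Finset.sum_le_sum fun j _ => hg.bound (y j)).trans ?_)
      simp
    have h3 := abs_sub (g (∑ j, y j)) (∑ j, g (y j))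
    have h4 := hg.bound (∑ j, y j)
    have h5 : (q + 1) * B ≤
        (q + 1) * B * ∑ i, ∑ j ∈ Finset.univ.erase i, far η (y i) * far η (y j) :=
      le_mul_of_one_le_right (by positivity) h1
    have h6 := mul_nonneg hδ hS1
    have h7 := mul_nonneg (mul_nonneg zero_le_two hB) hS2
    linarith
  · have hex : ∃ i, ∀ j, j ≠ i → ‖y j‖ ≤ η := by
      by_cases h : ∃ i, η < ‖y i‖
      · obtain ⟨i, hi⟩ := h
        refine ⟨i, fun j hj => ?_⟩
        by_contra hcon
        exact hcase ⟨i, j, hj.symm, hi, not_le.1 hcon⟩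
      · push Not at h
        exact ⟨0, fun j _ => h j⟩
    obtain ⟨i, hi⟩ := hex
    have hηq : η ≤ q * η := le_mul_of_one_le_left hη.le hq
    have h1 : ∑ j, g (y j) = g (y i) := by
      refine Finset.sum_eq_single i (fun j _ hj => ?_) (by simp)
      exact hg.vanish _ (by linarith [hi j hj])
    have h2 : ‖∑ j, y j - y i‖ ≤ q * η := by
      rw [← Finset.sum_erase_eq_sub (Finset.mem_univ i)]
      refine (norm_sum_le _ _).trans ((Finset.sum_le_card_nsmul _ _ η
        fun j hj => hi j (Finset.ne_of_mem_erase hj)).trans ?_)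
      rw [nsmul_eq_mul]
      refine mul_le_mul_of_nonneg_right ?_ hη.le
      exact_mod_cast (Finset.card_erase_le.trans (by simp))
    rw [h1]
    have h3 : 0 ≤ (q + 1) * B * ∑ i, ∑ j ∈ Finset.univ.erase i, far η (y i) * far η (y j) := by
      positivity
    have h6 := mul_nonneg hδ hS1
    have h7 := mul_nonneg (mul_nonneg zero_le_two hB) hS2
    -- Here the whole sum has norm at most `ε / 4 + ε / 2 < ε`, so `g` vanishes at both points. For
    -- larger `y i`, uniform continuity serves up to radius `R` and the bound `2 * B` beyond it.
    by_cases hsmall : ‖y i‖ ≤ ε / 4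
    · have h9 := norm_sub_norm_le (∑ j, y j) (y i)
      rw [hg.vanish _ (by linarith : ‖∑ j, y j‖ < ε), hg.vanish _ (by linarith : ‖y i‖ < ε)]
      simp only [sub_zero, abs_zero]
      linarith
    · have h8 : 1 ≤ ∑ j, far (ε / 4) (y j) := by
        refine le_trans ?_ (Finset.single_le_sum (fun j _ => far_nonneg _ _) (Finset.mem_univ i))
        rw [far_of_lt (not_le.1 hsmall)]
      by_cases hR : ‖y i‖ ≤ R
      · have h9 := huc _ _ hR h2
        have h10 := le_mul_of_one_le_right hδ h8
        linarith
      · have h9 : 1 ≤ ∑ j, far R (y j) := by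
          refine le_trans ?_ (Finset.single_le_sum (fun j _ => far_nonneg _ _) (Finset.mem_univ i))
          rw [far_of_lt (not_le.1 hR)]
        have h10 := le_mul_of_one_le_right (mul_nonneg zero_le_two hB) h9
        have h11 := abs_sub (g (∑ j, y j)) (g (y i))
        linarith [hg.bound (∑ j, y j), hg.bound (y i)]

theorem integral_far {Ω : Type*} [MeasurableSpace Ω] (P : Measure Ω)
    {Y : Ω → EuclideanSpace ℝ (Fin d)} (hY : AEMeasurable Y P) (r : ℝ) {s : ℝ} (hs : 0 < s) :
    ∫ ω, far r (s⁻¹ • Y ω) ∂P = tail (P.map Y) (r * s) := by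
  have h : ∀ x : EuclideanSpace ℝ (Fin d), far r (s⁻¹ • x) = far (r * s) x := fun x => by
    have : r < ‖s⁻¹ • x‖ ↔ r * s < ‖x‖ := by
      rw [norm_smul, norm_inv, Real.norm_of_nonneg hs.le, lt_inv_mul_iff₀ hs, mul_comm]
    simp only [far, Set.indicator_apply]
    exact if_congr this rfl rfl
  simp_rw [h]
  rw [← integral_map (f := far (r * s)) hY (measurable_far _).aestronglyMeasurable]
  unfold far
  rw [integral_indicator (measurableSet_lt_norm _), setIntegral_const, smul_eq_mul, mul_one, tail]

theorem integrable_far {Ω : Type*} [MeasurableSpace Ω] (P : Measure Ω) [IsFiniteMeasure P]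
    {Y : Ω → EuclideanSpace ℝ (Fin d)} (hY : AEMeasurable Y P) (r s : ℝ) :
    Integrable (fun ω => far r (s⁻¹ • Y ω)) P :=
  Integrable.of_bound ((measurable_far r).comp_aemeasurable
    (hY.const_smul s⁻¹)).aestronglyMeasurable 1 (Eventually.of_forall fun ω => by
      rw [Real.norm_of_nonneg (far_nonneg _ _)]; exact far_le_one _ _)

/-- For large values, a sum of independent vectors with power-bounded tails behaves like its
largest summand. -/
theorem tendsto_single_big_jump [NeZero q] {Ω : Type*} [MeasurableSpace Ω] (P : Measure Ω)
    [IsProbabilityMeasure P] {Y : Fin q → Ω → EuclideanSpace ℝ (Fin d)}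
    (hY : ∀ j, AEMeasurable (Y j) P) (hind : ∀ i j, i ≠ j → IndepFun (Y i) (Y j) P)
    {v : ℝ → ℝ} (hv : ∀ s, 0 < v s) {C α : ℝ} (hα : 0 < α)
    (htail : ∀ j, ∀ u : ℝ, 0 < u → ∀ᶠ s in atTop,
      tail (P.map (Y j)) (u * s) ≤ C * u ^ (-α) * v s)
    {g : EuclideanSpace ℝ (Fin d) → ℝ} {B ε : ℝ} (hg : IsTest g B ε) :
    Tendsto (fun s => (∫ ω, g (s⁻¹ • ∑ j, Y j ω) ∂P - ∑ j, ∫ ω, g (s⁻¹ • Y j ω) ∂P) / v s)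
      atTop (𝓝 0) := by
  have hB := hg.bound_nonneg
  have hε := hg.pos
  have hq : (0 : ℝ) < q := by exact_mod_cast NeZero.pos q
  have := fun j => Measure.isProbabilityMeasure_map (hY j)
  rw [Metric.tendsto_nhds]
  intro κ hκ
  -- Order of choice: `R` makes the far term small, then `δ` the continuity term, and then `η` comes
  -- from uniform continuity of `g` near the ball of radius `R`.
  have hpow : Tendsto (fun R : ℝ => 2 * B * (q * (C * R ^ (-α)))) atTop (𝓝 0) := by
    simpa using ((((tendsto_rpow_neg_atTop hα).const_mul C).const_mul (q : ℝ)).const_mul (2 * B))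
  obtain ⟨R, hRκ, hR0⟩ := ((hpow.eventually (gt_mem_nhds (show 0 < κ / 3 by positivity))).and
    (eventually_gt_atTop 0)).exists
  obtain ⟨δ, hδκ, hδ0⟩ : ∃ δ : ℝ, δ * (q * (C * (ε / 4) ^ (-α))) < κ / 3 ∧ 0 < δ := by
    have h1 : Tendsto (fun δ : ℝ => δ * (q * (C * (ε / 4) ^ (-α)))) (𝓝[>] 0) (𝓝 0) := by
      refine tendsto_nhdsWithin_of_tendsto_nhds ?_
      simpa using (tendsto_id (x := 𝓝 (0 : ℝ))).mul_const (q * (C * (ε / 4) ^ (-α)))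
    exact ((h1.eventually (gt_mem_nhds (show 0 < κ / 3 by positivity))).and
      self_mem_nhdsWithin).exists
  obtain ⟨η, hη0, hηε, huc⟩ : ∃ η : ℝ, 0 < η ∧ q * η ≤ ε / 2 ∧
      ∀ x y, ‖x‖ ≤ R → ‖y - x‖ ≤ q * η → |g y - g x| ≤ δ := by
    have h1 := (isCompact_closedBall (0 : EuclideanSpace ℝ (Fin d)) R).uniformContinuousAt_of_continuousAt
      g (fun a _ => hg.continuous.continuousAt) (Metric.dist_mem_uniformity hδ0)
    obtain ⟨r, hr, h2⟩ := Metric.mem_uniformity_dist.1 h1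
    refine ⟨min (ε / 2) (r / 2) / q, by positivity, ?_, fun x y hx hxy => ?_⟩
    · rw [mul_div_cancel₀ _ hq.ne']; exact min_le_left _ _
    · rw [mul_div_cancel₀ _ hq.ne'] at hxy
      have h3 : dist x y < r := by
        rw [dist_comm, dist_eq_norm]
        linarith [hxy.trans (min_le_right _ _)]
      have h4 := h2 h3 (by simpa using hx)
      rw [← Real.dist_eq, dist_comm]
      exact le_of_lt h4
  -- By independence the cross terms are products of two tails: one factor is bounded by a multiple
  -- of `v s`, the other still tends to `0`.
  have hcross : Tendsto (fun s => (q + 1) * B * ∑ i, ∑ j ∈ Finset.univ.erase i,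
      tail (P.map (Y i)) (η * s) * (C * η ^ (-α))) atTop (𝓝 0) := by
    have h1 : ∀ i, Tendsto (fun s => tail (P.map (Y i)) (η * s)) atTop (𝓝 0) := fun i =>
      (tendsto_tail_atTop (P.map (Y i))).comp (tendsto_id.const_mul_atTop hη0)
    have h2 := (tendsto_finsetSum Finset.univ fun i _ => tendsto_finsetSum
      (Finset.univ.erase i) fun j _ => (h1 i).mul_const (C * η ^ (-α))).const_mul ((q + 1) * B)
    simpa using h2
  filter_upwards [hcross.eventually (gt_mem_nhds (show 0 < κ / 3 by positivity)),
    eventually_all.2 fun j => htail j _ (show 0 < ε / 4 by positivity),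
    eventually_all.2 fun j => htail j _ hR0, eventually_all.2 fun j => htail j _ hη0,
    eventually_gt_atTop 0] with s hs1 hs2 hs3 hs4 hs0
  have hYs : ∀ j, AEMeasurable (fun ω => s⁻¹ • Y j ω) P := fun j => (hY j).const_smul s⁻¹
  have hgi : ∀ Y' : Ω → EuclideanSpace ℝ (Fin d), AEMeasurable Y' P →
      Integrable (fun ω => g (Y' ω)) P := fun Y' hY' =>
    Integrable.of_bound (hg.continuous.measurable.comp_aemeasurable hY').aestronglyMeasurable B
      (Eventually.of_forall fun ω => hg.bound _)
  have hsumi : Integrable (fun ω => g (s⁻¹ • ∑ j, Y j ω)) P :=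
    hgi _ ((Finset.aemeasurable_fun_sum _ fun j _ => hY j).const_smul s⁻¹)
  have hcr : ∀ i, ∀ j ∈ Finset.univ.erase i,
      Integrable (fun ω => far η (s⁻¹ • Y i ω) * far η (s⁻¹ • Y j ω)) P ∧
      ∫ ω, far η (s⁻¹ • Y i ω) * far η (s⁻¹ • Y j ω) ∂P =
        tail (P.map (Y i)) (η * s) * tail (P.map (Y j)) (η * s) := by
    intro i j hj
    have hm : Measurable fun x : EuclideanSpace ℝ (Fin d) => far η (s⁻¹ • x) :=
      (measurable_far η).comp (measurable_const_smul s⁻¹)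
    have hi := (hind i j (Finset.ne_of_mem_erase hj).symm).comp hm hm
    constructor
    · exact hi.integrable_mul (integrable_far P (hY i) η s) (integrable_far P (hY j) η s)
    · rw [← integral_far P (hY i) η hs0, ← integral_far P (hY j) η hs0]
      exact hi.integral_fun_mul_eq_mul_integral
        (integrable_far P (hY i) η s).aestronglyMeasurable
        (integrable_far P (hY j) η s).aestronglyMeasurable
  have hmain : |∫ ω, g (s⁻¹ • ∑ j, Y j ω) ∂P - ∑ j, ∫ ω, g (s⁻¹ • Y j ω) ∂P| ≤
      δ * ∑ j, tail (P.map (Y j)) (ε / 4 * s) + 2 * B * ∑ j, tail (P.map (Y j)) (R * s) +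
      (q + 1) * B * ∑ i, ∑ j ∈ Finset.univ.erase i,
        tail (P.map (Y i)) (η * s) * tail (P.map (Y j)) (η * s) := by
    have hI1 : Integrable (fun ω => δ * ∑ j, far (ε / 4) (s⁻¹ • Y j ω)) P :=
      (integrable_finsetSum _ fun j _ => integrable_far P (hY j) _ s).const_mul δ
    have hI2 : Integrable (fun ω => 2 * B * ∑ j, far R (s⁻¹ • Y j ω)) P :=
      (integrable_finsetSum _ fun j _ => integrable_far P (hY j) _ s).const_mul (2 * B)
    have hI3 : Integrable (fun ω => (q + 1) * B * ∑ i, ∑ j ∈ Finset.univ.erase i,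
        far η (s⁻¹ • Y i ω) * far η (s⁻¹ • Y j ω)) P :=
      (integrable_finsetSum _ fun i _ => integrable_finsetSum _ fun j hj =>
        (hcr i j hj).1).const_mul _
    rw [← integral_finsetSum _ fun j _ => hgi _ (hYs j),
      ← integral_sub hsumi (integrable_finsetSum _ fun j _ => hgi _ (hYs j))]
    refine abs_integral_le_integral_abs.trans ((integral_mono
      (hsumi.sub (integrable_finsetSum _ fun j _ => hgi _ (hYs j))).abs
      ((hI1.add hI2).add hI3) fun ω => ?_).trans (le_of_eq ?_))
    · have h := hg.abs_sub_sum_le hδ0.le hη0 hηε huc fun j => s⁻¹ • Y j ω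
      rw [← Finset.smul_sum] at h
      exact h
    · have hI12 : Integrable (fun ω => δ * ∑ j, far (ε / 4) (s⁻¹ • Y j ω) +
          2 * B * ∑ j, far R (s⁻¹ • Y j ω)) P := hI1.add hI2
      simp only [Pi.add_apply]
      rw [integral_add hI12 hI3, integral_add hI1 hI2, integral_const_mul,
        integral_const_mul, integral_const_mul,
        integral_finsetSum _ fun j _ => integrable_far P (hY j) _ s,
        integral_finsetSum _ fun j _ => integrable_far P (hY j) _ s,
        integral_finsetSum _ fun i _ => integrable_finsetSum _ fun j hj => (hcr i j hj).1]
      congr 1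
      · congr 2 <;> exact Finset.sum_congr rfl fun j _ => integral_far P (hY j) _ hs0
      · congr 1
        refine Finset.sum_congr rfl fun i _ => ?_
        rw [integral_finsetSum _ fun j hj => (hcr i j hj).1]
        exact Finset.sum_congr rfl fun j hj => (hcr i j hj).2
  have hsum : ∀ r : ℝ, (∀ j, tail (P.map (Y j)) (r * s) ≤ C * r ^ (-α) * v s) →
      ∑ j, tail (P.map (Y j)) (r * s) ≤ q * (C * r ^ (-α)) * v s := fun r hr => by
    refine (Finset.sum_le_sum fun j _ => hr j).trans (le_of_eq ?_)
    simp [mul_assoc]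
  have b1 := mul_le_mul_of_nonneg_left (hsum _ hs2) hδ0.le
  have b2 := mul_le_mul_of_nonneg_left (hsum _ hs3) (show 0 ≤ 2 * B by positivity)
  have b3 : (q + 1) * B * ∑ i, ∑ j ∈ Finset.univ.erase i,
        tail (P.map (Y i)) (η * s) * tail (P.map (Y j)) (η * s) ≤
      ((q + 1) * B * ∑ i, ∑ j ∈ Finset.univ.erase i,
        tail (P.map (Y i)) (η * s) * (C * η ^ (-α))) * v s := by
    rw [mul_assoc ((q + 1) * B), Finset.sum_mul]
    refine mul_le_mul_of_nonneg_left (Finset.sum_le_sum fun i _ => ?_) (by positivity)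
    rw [Finset.sum_mul]
    refine Finset.sum_le_sum fun j _ => ?_
    rw [mul_assoc]
    exact mul_le_mul_of_nonneg_left (hs4 j) (tail_nonneg _ _)
  rw [Real.dist_eq, sub_zero, abs_div, abs_of_pos (hv s), div_lt_iff₀ (hv s)]
  have c1 := mul_lt_mul_of_pos_right hδκ (hv s)
  have c2 := mul_lt_mul_of_pos_right hRκ (hv s)
  have c3 := mul_lt_mul_of_pos_right hs1 (hv s)
  refine hmain.trans_lt ?_
  linarith

end SingleBigJump

/-! ### Oscillation at infinity and the contraction argument. -/

section Oscillation

/-- The oscillation of `F` at infinity is at most `c`. -/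
def OscLE (F : ℝ → ℝ) (c : ℝ) : Prop :=
  ∀ δ > 0, ∀ᶠ p : ℝ × ℝ in atTop ×ˢ atTop, |F p.1 - F p.2| ≤ c + δ

theorem oscLE_of_eventually_abs_le {F : ℝ → ℝ} {c : ℝ} (h : ∀ᶠ s in atTop, |F s| ≤ c) :
    OscLE F (2 * c) := fun δ hδ => by
  filter_upwards [h.prod_mk h] with p hp
  linarith [abs_sub (F p.1) (F p.2), hp.1, hp.2]

theorem oscLE_zero_of_tendsto {F : ℝ → ℝ} {l : ℝ} (h : Tendsto F atTop (𝓝 l)) :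
    OscLE F 0 := fun δ hδ => by
  have h1 : ∀ᶠ s in atTop, dist (F s) l < δ / 2 :=
    h.eventually (Metric.ball_mem_nhds l (half_pos hδ))
  filter_upwards [h1.prod_mk h1] with p hp
  have := dist_triangle_right (F p.1) (F p.2) l
  rw [← Real.dist_eq]
  linarith [hp.1, hp.2]

theorem exists_tendsto_of_oscLE_zero {F : ℝ → ℝ} (h : OscLE F 0) :
    ∃ l, Tendsto F atTop (𝓝 l) := by
  refine cauchy_map_iff_exists_tendsto.1 ?_
  rw [cauchy_map_iff]
  refine ⟨inferInstance, ?_⟩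
  refine Metric.uniformity_basis_dist_le.tendsto_right_iff.2 fun δ hδ => ?_
  filter_upwards [h δ hδ] with p hp
  simpa [Real.dist_eq] using hp

/-- The total does not oscillate, so `F` can oscillate only as much as the `H j` compensate. -/
theorem OscLE.of_add_sum {ι : Type*} (S : Finset ι) {F : ℝ → ℝ} {H : ι → ℝ → ℝ} {c : ι → ℝ}
    (h : OscLE (fun s => F s + ∑ j ∈ S, H j s) 0) (hH : ∀ j ∈ S, OscLE (H j) (c j)) :
    OscLE F (∑ j ∈ S, c j) := fun δ hδ => by
  have hk : (0 : ℝ) < δ / (S.card + 1) := by positivity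
  filter_upwards [h _ hk, (Finset.eventually_all S).2 fun j hj => hH j hj _ hk] with p hp hpH
  have h1 : ∑ j ∈ S, |H j p.1 - H j p.2| ≤ ∑ j ∈ S, c j + S.card * (δ / (S.card + 1)) := by
    refine (Finset.sum_le_sum hpH).trans (le_of_eq ?_)
    rw [Finset.sum_add_distrib, Finset.sum_const, nsmul_eq_mul]
  have h2 : F p.1 - F p.2 = (F p.1 + ∑ j ∈ S, H j p.1 - (F p.2 + ∑ j ∈ S, H j p.2)) -
      ∑ j ∈ S, (H j p.1 - H j p.2) := by
    rw [Finset.sum_sub_distrib]; ring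
  have h3 : (S.card : ℝ) * (δ / (S.card + 1)) + δ / (S.card + 1) = δ := by
    field_simp
  rw [h2]
  refine (abs_sub _ _).trans ?_
  have h4 := Finset.abs_sum_le_sum_abs (fun j => H j p.1 - H j p.2) S
  linarith

theorem oscLE_zero_of_geometric {F : ℝ → ℝ} {c ρ : ℝ} (h0 : 0 ≤ ρ) (h1 : ρ < 1)
    (h : ∀ n : ℕ, OscLE F (c * ρ ^ n)) : OscLE F 0 := fun δ hδ => by
  have h2 : Tendsto (fun n : ℕ => c * ρ ^ n) atTop (𝓝 0) := by
    simpa using (tendsto_pow_atTop_nhds_zero_of_lt_one h0 h1).const_mul c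
  obtain ⟨n, hn⟩ := (h2.eventually (gt_mem_nhds (half_pos hδ))).exists
  filter_upwards [h n _ (half_pos hδ)] with p hp
  linarith

variable {d : ℕ}

/-- A contraction criterion for the convergence of a family of functionals on test functions. -/
theorem exists_tendsto_of_contraction {ι : Type*} (S : Finset ι)
    (K : (EuclideanSpace ℝ (Fin d) → ℝ) → ℝ → ℝ) {C α : ℝ}
    (hK : ∀ g B ε, IsTest g B ε → ∀ᶠ s in atTop, |K g s| ≤ C * (B * ε ^ (-α)))
    (A : ι → EuclideanSpace ℝ (Fin d) → EuclideanSpace ℝ (Fin d)) (hA : ∀ j, Continuous (A j))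
    {a : ι → ℝ} (ha : ∀ j, 0 < a j) (hAn : ∀ j x, ‖A j x‖ ≤ a j * ‖x‖)
    (hsum : ∑ j ∈ S, a j ^ α < 1)
    (hrec : ∀ g B ε, IsTest g B ε →
      ∃ l, Tendsto (fun s => K g s + ∑ j ∈ S, K (fun x => g (A j x)) s) atTop (𝓝 l))
    {g : EuclideanSpace ℝ (Fin d) → ℝ} {B ε : ℝ} (hg : IsTest g B ε) :
    ∃ l, Tendsto (K g) atTop (𝓝 l) := by
  -- The claim is made for all test functions at once because the induction step applies it to each
  -- `g ∘ A j`, whose radius is `ε / a j`; this produces the factor `a j ^ α`.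
  have hosc : ∀ n : ℕ, ∀ g B ε, IsTest g B ε →
      OscLE (K g) (2 * (C * (B * ε ^ (-α))) * (∑ j ∈ S, a j ^ α) ^ n) := by
    intro n
    induction n with
    | zero =>
      intro g B ε hg
      rw [pow_zero, mul_one]
      exact oscLE_of_eventually_abs_le (hK g B ε hg)
    | succ n ih =>
      intro g B ε hg
      obtain ⟨l, hl⟩ := hrec g B ε hg
      have h1 := OscLE.of_add_sum S (oscLE_zero_of_tendsto hl) fun j _ =>
        ih _ _ _ (hg.comp_of_norm_le (hA j) (ha j) (hAn j))
      convert h1 using 1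
      rw [pow_succ', Finset.sum_mul, Finset.mul_sum]
      refine Finset.sum_congr rfl fun j _ => ?_
      rw [Real.div_rpow hg.pos.le (ha j).le, Real.rpow_neg (ha j).le, div_inv_eq_mul]
      ring
  exact exists_tendsto_of_oscLE_zero (oscLE_zero_of_geometric
    (Finset.sum_nonneg fun j _ => (Real.rpow_nonneg (ha j).le _)) hsum fun n => hosc n g B ε hg)

end Oscillation

/-! ### The limit measure from the Riesz representation theorem. -/

section LimitMeasure

variable {d : ℕ}

theorem restr_add (f h : C_c(ExtPunctured d, ℝ)) :
    restr (f + h : C_c(ExtPunctured d, ℝ)) = fun x => restr f x + restr h x := by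
  ext x
  by_cases hx : x = 0
  · simp [hx, restr_zero]
  · simp [restr_of_ne _ hx]

theorem restr_smul (c : ℝ) (f : C_c(ExtPunctured d, ℝ)) :
    restr (c • f : C_c(ExtPunctured d, ℝ)) = fun x => c * restr f x := by
  ext x
  by_cases hx : x = 0
  · simp [hx, restr_zero]
  · simp [restr_of_ne _ hx]

theorem ratio_add (ν ρ : Measure (EuclideanSpace ℝ (Fin d))) [IsFiniteMeasure ν]
    {g h : EuclideanSpace ℝ (Fin d) → ℝ} {B B' ε ε' : ℝ} (hg : IsTest g B ε)
    (hh : IsTest h B' ε') (s : ℝ) :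
    ratio ν ρ (fun x => g x + h x) s = ratio ν ρ g s + ratio ν ρ h s := by
  rw [ratio, ratio, ratio, integral_add (hg.integrable_scaled ν s) (hh.integrable_scaled ν s),
    add_div]

/-- Pointwise convergence of the scaled ratios on compactly supported functions produces a limit
measure. -/
theorem exists_measure_of_tendsto (ν ρ : Measure (EuclideanSpace ℝ (Fin d))) [IsFiniteMeasure ν]
    (h : ∀ f : C_c(ExtPunctured d, ℝ), ∃ l, Tendsto (ratio ν ρ (restr f)) atTop (𝓝 l)) :
    ∃ μ : Measure (ExtPunctured d), IsFiniteMeasureOnCompacts μ ∧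
      ∀ f : C_c(ExtPunctured d, ℝ), Tendsto (ratio ν ρ (restr f)) atTop (𝓝 (∫ x, f x ∂μ)) := by
  choose l hl using h
  let Λ : C_c(ExtPunctured d, ℝ) →ₗ[ℝ] ℝ :=
    { toFun := l
      map_add' := fun f g => by
        obtain ⟨_, _, hf⟩ := exists_isTest_restr f
        obtain ⟨_, _, hg⟩ := exists_isTest_restr g
        refine tendsto_nhds_unique (hl (f + g)) (((hl f).add (hl g)).congr fun s => ?_)
        rw [restr_add, ratio_add ν ρ hf hg]
      map_smul' := fun c f => by
        refine tendsto_nhds_unique (hl (c • f)) (((hl f).const_mul c).congr fun s => ?_)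
        rw [restr_smul, ratio_const_mul] }
  let Λ' : C_c(ExtPunctured d, ℝ) →ₚ[ℝ] ℝ := PositiveLinearMap.mk₀ Λ fun f hf => by
    refine ge_of_tendsto' (hl f) fun s => ?_
    refine div_nonneg (integral_nonneg fun x => ?_) (tail_nonneg _ _)
    change 0 ≤ restr f _
    by_cases hx : s⁻¹ • x = 0
    · rw [hx, restr_zero]
    · rw [restr_of_ne _ hx]; exact hf _
  have : (RealRMK.rieszMeasure Λ').Regular := inferInstance
  refine ⟨RealRMK.rieszMeasure Λ', inferInstance, fun f => ?_⟩
  rw [RealRMK.integral_rieszMeasure]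
  exact hl f

theorem farStep_of_mem_infinitePoints {R : ℝ} (hR : 0 < R) {x : ExtPunctured d}
    (hx : x ∈ infinitePoints d) : farStep R x.1 = 1 := by
  rcases eq_coeExt_clampExt_or_le_norm (R := 2 * R) (by linarith) x.1 with h | h
  · obtain ⟨i, hi⟩ := hx
    rw [← h] at hi
    simp [coeExt] at hi
  · exact step_of_ge ((le_div_iff₀ hR).2 h)

/-- Every cutoff equals `1` at the infinite points, so their mass is at most `C * R ^ (-α)` for
every `R`. -/
theorem infinitePoints_null_of_integral_le (μ : Measure (ExtPunctured d))
    [IsFiniteMeasureOnCompacts μ] {C α : ℝ} (hα : 0 < α)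
    (h : ∀ (R : ℝ) (hR : 0 < R), ∫ x, farCutoff hR x ∂μ ≤ C * R ^ (-α)) :
    μ (infinitePoints d) = 0 := by
  have hle : ∀ R : ℝ, 0 < R → μ (infinitePoints d) ≤ ENNReal.ofReal (C * R ^ (-α)) := by
    intro R hR
    have hint : Integrable (farCutoff (d := d) hR) μ :=
      (farCutoff hR).continuous.integrable_of_hasCompactSupport (farCutoff hR).hasCompactSupport
    have h1 : μ (infinitePoints d) ≤ ∫⁻ x, ENNReal.ofReal (farCutoff hR x) ∂μ := by
      rw [← lintegral_indicator_one measurableSet_infinitePoints]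
      refine lintegral_mono fun x => ?_
      by_cases hx : x ∈ infinitePoints d
      · change _ ≤ ENNReal.ofReal (farStep R x.1)
        rw [farStep_of_mem_infinitePoints hR hx, Set.indicator_of_mem hx]; simp
      · rw [Set.indicator_of_notMem hx]; exact bot_le
    rw [← ofReal_integral_eq_lintegral_ofReal hint
      (Eventually.of_forall fun x => farStep_nonneg _ _)] at h1
    exact h1.trans (ENNReal.ofReal_le_ofReal (h R hR))
  have hlim : Tendsto (fun R : ℝ => ENNReal.ofReal (C * R ^ (-α))) atTop (𝓝 0) := by
    have := ENNReal.tendsto_ofReal ((tendsto_rpow_neg_atTop hα).const_mul C)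
    simpa using this
  refine le_antisymm (ge_of_tendsto hlim ?_) bot_le
  filter_upwards [eventually_gt_atTop 0] with R hR using hle R hR

end LimitMeasure

/-! ### Convergence of the quotient of tails. -/

section TailLimit

variable {d : ℕ}

/-- A continuous function equal to `0` on the unit ball and to `1` outside the ball of radius
`1 + δ`. -/
noncomputable def ramp (δ : ℝ) (x : EuclideanSpace ℝ (Fin d)) : ℝ :=
  max 0 (min 1 ((‖x‖ - 1) / δ))

theorem isTest_ramp {δ : ℝ} (hδ : 0 < δ) : IsTest (ramp (d := d) δ) 1 1 where
  continuous := by unfold ramp; fun_prop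
  bound x := by
    rw [abs_of_nonneg (le_max_left _ _)]
    exact max_le zero_le_one (min_le_left _ _)
  pos := zero_lt_one
  vanish x hx := max_eq_left ((min_le_right _ _).trans
    (div_nonpos_of_nonpos_of_nonneg (by linarith) hδ.le))

theorem ramp_nonneg (δ : ℝ) (x : EuclideanSpace ℝ (Fin d)) : 0 ≤ ramp δ x := le_max_left _ _

theorem ramp_of_ge {δ : ℝ} (hδ : 0 < δ) {x : EuclideanSpace ℝ (Fin d)} (h : 1 + δ ≤ ‖x‖) :
    ramp δ x = 1 := by
  rw [ramp, min_eq_left ((one_le_div hδ).2 (by linarith))]; simp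

theorem ramp_le_far {δ : ℝ} (hδ : 0 < δ) (x : EuclideanSpace ℝ (Fin d)) : ramp δ x ≤ far 1 x := by
  by_cases hx : 1 < ‖x‖
  · rw [far_of_lt hx]; exact max_le zero_le_one (min_le_left _ _)
  · have : ramp δ x = 0 := max_eq_left ((min_le_right _ _).trans
      (div_nonpos_of_nonpos_of_nonneg (by linarith) hδ.le))
    rw [this]; exact far_nonneg _ _

theorem far_le_ramp {δ : ℝ} (hδ : 0 < δ) (x : EuclideanSpace ℝ (Fin d)) :
    far 1 x ≤ ramp δ ((1 + δ) • x) := by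
  by_cases hx : 1 < ‖x‖
  · rw [far_of_lt hx, ramp_of_ge hδ]
    rw [norm_smul, Real.norm_of_nonneg (by linarith)]
    exact le_mul_of_one_le_right (by linarith) hx.le
  · have : far 1 x = 0 := Set.indicator_of_notMem (by exact hx) _
    rw [this]; exact ramp_nonneg _ _

variable (ζ ν : Measure (EuclideanSpace ℝ (Fin d))) [IsFiniteMeasure ζ] (hν : ∀ s, 0 < tail ν s)
  (m : Measure (EuclideanSpace ℝ (Fin d))) {α : ℝ}
  (hfin : ∀ ε : ℝ, 0 < ε → m {x | ε ≤ ‖x‖} < ⊤)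
  (hint : ∀ g B ε, IsTest g B ε → Integrable g m)
  (hhom : ∀ g B ε, IsTest g B ε → ∀ t : ℝ, 0 < t → ∫ x, g (t • x) ∂m = t ^ α * ∫ x, g x ∂m)

include hfin hint hhom

/-- The indicator lies between the ramp and its dilate by `1 + δ`, and homogeneity compares the
integrals of these two. -/
theorem integral_ramp_le_and_le {δ : ℝ} (hδ : 0 < δ) :
    ∫ x, ramp δ x ∂m ≤ tail m 1 ∧ tail m 1 ≤ (1 + δ) ^ α * ∫ x, ramp δ x ∂m := by
  have h1 : ∫ x, far 1 x ∂m = tail m 1 := by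
    unfold far
    rw [integral_indicator (measurableSet_lt_norm _), setIntegral_const, smul_eq_mul, mul_one, tail]
  have h2 : Integrable (far (d := d) 1) m :=
    (integrable_indicator_iff (measurableSet_lt_norm 1)).2 (integrableOn_const
      ((measure_mono fun x (hx : 1 < ‖x‖) => hx.le).trans_lt (hfin 1 one_pos)).ne)
  have hδ' : 0 < 1 + δ := by linarith
  rw [← h1, ← hhom _ _ _ (isTest_ramp hδ) _ hδ']
  exact ⟨integral_mono (hint _ _ _ (isTest_ramp hδ)) h2 fun x => ramp_le_far hδ x,
    integral_mono h2 (hint _ _ _ ((isTest_ramp hδ).comp_smul hδ')) fun x => far_le_ramp hδ x⟩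

include hν in
-- The indicator of `{x | 1 < ‖x‖}` is not continuous, so it is squeezed between ramps. Letting `δ`
-- tend to `0` closes the gap by homogeneity, with no separate proof that the unit sphere is null.
theorem tendsto_tail_div_of_tendsto_ratio
    (hlim : ∀ g B ε, IsTest g B ε → Tendsto (ratio ζ ν g) atTop (𝓝 (∫ x, g x ∂m))) :
    Tendsto (fun s => tail ζ s / tail ν s) atTop (𝓝 (tail m 1)) := by
  have hζ : ∀ s, 0 < s → ∫ x, far 1 (s⁻¹ • x) ∂ζ = tail ζ s := fun s hs => by
    have := integral_far ζ (Y := id) aemeasurable_id 1 hs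
    simpa using this
  have hfi : ∀ s, Integrable (fun x => far 1 (s⁻¹ • x)) ζ := fun s =>
    integrable_far ζ (Y := id) aemeasurable_id 1 s
  have hcont : Tendsto (fun δ : ℝ => (1 + δ) ^ α) (𝓝[>] 0) (𝓝 1) := by
    refine tendsto_nhdsWithin_of_tendsto_nhds ?_
    have : ContinuousAt (fun δ : ℝ => (1 + δ) ^ α) 0 :=
      (continuousAt_const.add continuousAt_id).rpow_const (Or.inl (by simp))
    simpa [ContinuousAt] using this
  rw [tendsto_order]
  constructor
  · intro a ha
    have h1 : Tendsto (fun δ : ℝ => tail m 1 / (1 + δ) ^ α) (𝓝[>] 0) (𝓝 (tail m 1)) := by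
      have := (tendsto_const_nhds (x := tail m 1)).div hcont one_ne_zero
      rwa [div_one] at this
    obtain ⟨δ, hδa, hδ⟩ := ((h1.eventually (lt_mem_nhds ha)).and self_mem_nhdsWithin).exists
    have hδ : 0 < δ := hδ
    have h2 := (integral_ramp_le_and_le m hfin hint hhom hδ).2
    rw [mul_comm, ← div_le_iff₀ (by positivity)] at h2
    filter_upwards [(hlim _ _ _ (isTest_ramp hδ)).eventually (lt_mem_nhds (hδa.trans_le h2)),
      eventually_gt_atTop 0] with s hs hs0
    refine hs.trans_le (div_le_div_of_nonneg_right ?_ (hν s).le)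
    rw [← hζ s hs0]
    exact integral_mono ((isTest_ramp hδ).integrable_scaled ζ s) (hfi s) fun x => ramp_le_far hδ _
  · intro b hb
    have h1 : Tendsto (fun δ : ℝ => (1 + δ) ^ α * tail m 1) (𝓝[>] 0) (𝓝 (tail m 1)) := by
      simpa using hcont.mul_const (tail m 1)
    obtain ⟨δ, hδb, hδ⟩ := ((h1.eventually (gt_mem_nhds hb)).and self_mem_nhdsWithin).exists
    have hδ : 0 < δ := hδ
    have hδ' : 0 < 1 + δ := by linarith
    have h2 := (integral_ramp_le_and_le m hfin hint hhom hδ).1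
    have h3 : ∫ x, ramp δ ((1 + δ) • x) ∂m < b := by
      rw [hhom _ _ _ (isTest_ramp hδ) _ hδ']
      exact (mul_le_mul_of_nonneg_left h2 (by positivity)).trans_lt hδb
    filter_upwards [(hlim _ _ _ ((isTest_ramp hδ).comp_smul hδ')).eventually (gt_mem_nhds h3),
      eventually_gt_atTop 0] with s hs hs0
    refine lt_of_le_of_lt (div_le_div_of_nonneg_right ?_ (hν s).le) hs
    rw [← hζ s hs0]
    exact integral_mono (hfi s) (((isTest_ramp hδ).comp_smul hδ').integrable_scaled ζ s)
      fun x => far_le_ramp hδ _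

/-- If the mass outside the unit ball were zero, homogeneity would make the integral of every
dilated ramp zero, and a multiple of one of them dominates `|g|`. -/
theorem tail_one_pos_of_integral_ne_zero {g : EuclideanSpace ℝ (Fin d) → ℝ} {B ε : ℝ}
    (hg : IsTest g B ε) (h : ∫ x, g x ∂m ≠ 0) : 0 < tail m 1 := by
  by_contra hcon
  have h0 : ∫ x, ramp 1 x ∂m = 0 :=
    le_antisymm (((integral_ramp_le_and_le m hfin hint hhom one_pos).1).trans (not_lt.1 hcon))
      (integral_nonneg fun x => ramp_nonneg _ _)
  have hε := hg.pos
  -- This dilation takes norm `ε` to `2`, where `ramp 1` reaches the value `1`.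
  have ht : 0 < 2 / ε := by positivity
  have h1 : ∫ x, ramp 1 ((2 / ε) • x) ∂m = 0 := by
    rw [hhom _ _ _ (isTest_ramp one_pos) _ ht, h0, mul_zero]
  refine h (abs_nonpos_iff.1 (abs_integral_le_integral_abs.trans ?_))
  have h2 : ∫ x, B * ramp 1 ((2 / ε) • x) ∂m = 0 := by rw [integral_const_mul, h1, mul_zero]
  rw [← h2]
  refine integral_mono (hint _ _ _ hg).abs
    ((hint _ _ _ ((isTest_ramp one_pos).comp_smul ht)).const_mul B) fun x => ?_
  change |g x| ≤ B * ramp 1 ((2 / ε) • x)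
  by_cases hx : ‖x‖ < ε
  · rw [hg.vanish x hx, abs_zero]
    exact mul_nonneg hg.bound_nonneg (ramp_nonneg _ _)
  · rw [ramp_of_ge one_pos, mul_one]
    · exact hg.bound x
    · rw [norm_smul, Real.norm_of_nonneg ht.le, div_mul_eq_mul_div, le_div_iff₀ hε]
      linarith [not_lt.1 hx]

end TailLimit

/-! ### Minimal stretch and operator norm. -/

section Stretch

variable {d : ℕ}

theorem minStretch_mul_norm_le (Ψ : Matrix (Fin d) (Fin d) ℝ) (z : EuclideanSpace ℝ (Fin d)) :
    minStretch Ψ * ‖z‖ ≤ ‖Matrix.toEuclideanCLM (𝕜 := ℝ) Ψ z‖ := by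
  by_cases hz : z = 0
  · simp [hz]
  · have hz' : 0 < ‖z‖ := norm_pos_iff.2 hz
    have h : minStretch Ψ ≤ ‖Matrix.toEuclideanCLM (𝕜 := ℝ) Ψ (‖z‖⁻¹ • z)‖ :=
      csInf_le ⟨0, by rintro _ ⟨y, -, rfl⟩; exact norm_nonneg _⟩
        ⟨‖z‖⁻¹ • z, by simp [norm_smul, hz'.ne'], rfl⟩
    rwa [map_smul, norm_smul, norm_inv, norm_norm, inv_mul_eq_div, le_div_iff₀ hz'] at h

theorem minStretch_nonneg (Ψ : Matrix (Fin d) (Fin d) ℝ) : 0 ≤ minStretch Ψ :=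
  Real.sInf_nonneg (by rintro _ ⟨y, -, rfl⟩; exact norm_nonneg _)

/-- In dimension `0` the unit sphere is empty and the infimum takes its default value `0`. The case
`d = 0` is thereby excluded. -/
theorem nontrivial_of_minStretch_pos {Ψ : Matrix (Fin d) (Fin d) ℝ} (h : 0 < minStretch Ψ) :
    Nontrivial (EuclideanSpace ℝ (Fin d)) := by
  by_contra hcon
  rw [not_nontrivial_iff_subsingleton] at hcon
  have : Metric.sphere (0 : EuclideanSpace ℝ (Fin d)) 1 = ∅ := by
    ext x
    simp [Subsingleton.elim x 0]
  rw [minStretch, this, Set.image_empty, Real.sInf_empty] at h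
  exact lt_irrefl _ h

theorem toEuclideanCLM_nonsing_inv_mul {Ψ : Matrix (Fin d) (Fin d) ℝ} (h : IsUnit Ψ)
    (x : EuclideanSpace ℝ (Fin d)) :
    Matrix.toEuclideanCLM (𝕜 := ℝ) Ψ⁻¹ (Matrix.toEuclideanCLM (𝕜 := ℝ) Ψ x) = x := by
  rw [← mul_apply_eq_comp, ← map_mul,
    Matrix.nonsing_inv_mul _ ((Matrix.isUnit_iff_isUnit_det _).1 h), map_one]
  rfl

theorem toEuclideanCLM_mul_nonsing_inv {Ψ : Matrix (Fin d) (Fin d) ℝ} (h : IsUnit Ψ)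
    (x : EuclideanSpace ℝ (Fin d)) :
    Matrix.toEuclideanCLM (𝕜 := ℝ) Ψ (Matrix.toEuclideanCLM (𝕜 := ℝ) Ψ⁻¹ x) = x := by
  rw [← mul_apply_eq_comp, ← map_mul,
    Matrix.mul_nonsing_inv _ ((Matrix.isUnit_iff_isUnit_det _).1 h), map_one]
  rfl

theorem norm_toEuclideanCLM_inv_le {Ψ : Matrix (Fin d) (Fin d) ℝ} (h : IsUnit Ψ)
    (hγ : 0 < minStretch Ψ) (x : EuclideanSpace ℝ (Fin d)) :
    ‖Matrix.toEuclideanCLM (𝕜 := ℝ) Ψ⁻¹ x‖ ≤ (minStretch Ψ)⁻¹ * ‖x‖ := by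
  have := minStretch_mul_norm_le Ψ (Matrix.toEuclideanCLM (𝕜 := ℝ) Ψ⁻¹ x)
  rw [toEuclideanCLM_mul_nonsing_inv h] at this
  rwa [inv_mul_eq_div, le_div_iff₀ hγ, mul_comm]

theorem matrixOpNorm_pos [Nontrivial (EuclideanSpace ℝ (Fin d))]
    {Ψ : Matrix (Fin d) (Fin d) ℝ} (h : IsUnit Ψ) : 0 < matrixOpNorm Ψ := by
  refine norm_pos_iff.2 fun h0 => ?_
  obtain ⟨x, hx⟩ := exists_ne (0 : EuclideanSpace ℝ (Fin d))
  have := toEuclideanCLM_nonsing_inv_mul h x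
  rw [h0, zero_apply, map_zero] at this
  exact hx this.symm

end Stretch

/-! ### Assembly of the proof. -/

section Main

variable {d : ℕ}

theorem ratio_change (ν ρ ρ' : Measure (EuclideanSpace ℝ (Fin d))) (hρ : ∀ s, 0 < tail ρ s)
    (g : EuclideanSpace ℝ (Fin d) → ℝ) (s : ℝ) :
    ratio ν ρ g s / (tail ρ' s / tail ρ s) = ratio ν ρ' g s := by
  rw [ratio, ratio, div_div_div_cancel_right₀ (hρ s).ne']

theorem ratio_map_eq {Ω : Type*} [MeasurableSpace Ω] (P : Measure Ω)
    {Y : Ω → EuclideanSpace ℝ (Fin d)} (hY : AEMeasurable Y P)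
    (ρ : Measure (EuclideanSpace ℝ (Fin d))) {g : EuclideanSpace ℝ (Fin d) → ℝ}
    (hg : Continuous g) (s : ℝ) :
    ratio (P.map Y) ρ g s = (∫ ω, g (s⁻¹ • Y ω) ∂P) / tail ρ s := by
  rw [ratio, integral_map (f := fun x => g (s⁻¹ • x)) hY (hg.comp (continuous_const_smul _)).aestronglyMeasurable]

theorem integral_linearImage {f : C_c(ExtPunctured d, ℝ)} (Ψ : Matrix (Fin d) (Fin d) ℝ)
    (μ : Measure (ExtPunctured d)) :
    ∫ x, f x ∂(linearImage Ψ μ) =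
      ∫ x, restr f (Matrix.toEuclideanCLM (𝕜 := ℝ) Ψ x) ∂(finitePart μ) := by
  obtain ⟨_, _, hf⟩ := exists_isTest_restr f
  rw [linearImage, integral_toExt, integral_map
    (Matrix.toEuclideanCLM (𝕜 := ℝ) Ψ).continuous.aemeasurable hf.continuous.aestronglyMeasurable]

theorem IsTest.comp_toEuclideanCLM [Nontrivial (EuclideanSpace ℝ (Fin d))]
    {g : EuclideanSpace ℝ (Fin d) → ℝ} {B ε : ℝ} (hg : IsTest g B ε)
    {Ψ : Matrix (Fin d) (Fin d) ℝ} (h : IsUnit Ψ) :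
    IsTest (fun x => g (Matrix.toEuclideanCLM (𝕜 := ℝ) Ψ x)) B (ε / matrixOpNorm Ψ) :=
  hg.comp_of_norm_le (Matrix.toEuclideanCLM (𝕜 := ℝ) Ψ).continuous (matrixOpNorm_pos h)
    (Matrix.toEuclideanCLM (𝕜 := ℝ) Ψ).le_opNorm

theorem integrable_linearImage [Nontrivial (EuclideanSpace ℝ (Fin d))]
    (f : C_c(ExtPunctured d, ℝ)) {Ψ : Matrix (Fin d) (Fin d) ℝ} (h : IsUnit Ψ)
    (μ : Measure (ExtPunctured d)) [IsFiniteMeasureOnCompacts μ] :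
    Integrable f (linearImage Ψ μ) := by
  obtain ⟨_, _, hf⟩ := exists_isTest_restr f
  refine integrable_toExt _ _ ?_
  rw [integrable_map_measure hf.continuous.aestronglyMeasurable
    (Matrix.toEuclideanCLM (𝕜 := ℝ) Ψ).continuous.aemeasurable]
  exact (hf.comp_toEuclideanCLM h).integrable_finitePart μ

/-- A power bound for the tail of `ζ` relative to the tail of `ν`, and convergence of the scaled
ratios, produce a homogeneous limit measure. -/
theorem exists_homogeneous_measure (ζ ν : Measure (EuclideanSpace ℝ (Fin d))) [IsFiniteMeasure ζ]
    (hν : ∀ s, 0 < tail ν s) {C α : ℝ} (hα : 0 < α)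
    (hνα : ∀ u : ℝ, 0 < u → Tendsto (fun s => tail ν (u * s) / tail ν s) atTop (𝓝 (u ^ (-α))))
    (hbound : ∀ g B ε, IsTest g B ε → ∀ᶠ s in atTop, |ratio ζ ν g s| ≤ C * (B * ε ^ (-α)))
    (hconv : ∀ g B ε, IsTest g B ε → ∃ l, Tendsto (ratio ζ ν g) atTop (𝓝 l)) :
    ∃ μ : Measure (ExtPunctured d), IsFiniteMeasureOnCompacts μ ∧ μ (infinitePoints d) = 0 ∧
      (∀ t : ℝ, 0 < t → ∀ A : Set (ExtPunctured d), MeasurableSet A →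
        μ (dilate t A) = ENNReal.ofReal (t ^ (-α)) * μ A) ∧
      (∀ g B ε, IsTest g B ε → ∀ t : ℝ, 0 < t →
        ∫ x, g (t • x) ∂(finitePart μ) = t ^ α * ∫ x, g x ∂(finitePart μ)) ∧
      ∀ g B ε, IsTest g B ε → Tendsto (ratio ζ ν g) atTop (𝓝 (∫ x, g x ∂(finitePart μ))) := by
  obtain ⟨μ, hμ, hlim⟩ := exists_measure_of_tendsto ζ ν fun f => by
    obtain ⟨B, ε, hf⟩ := exists_isTest_restr f
    exact hconv _ _ _ hf
  have hnull : μ (infinitePoints d) = 0 := by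
    refine infinitePoints_null_of_integral_le μ (C := C) hα fun R hR => ?_
    refine le_of_tendsto (hlim (farCutoff hR)) ?_
    filter_upwards [hbound _ _ _ (isTest_farCutoff (d := d) hR)] with s hs
    rw [one_mul] at hs
    exact (le_abs_self _).trans hs
  have hall : ∀ g B ε, IsTest g B ε →
      Tendsto (ratio ζ ν g) atTop (𝓝 (∫ x, g x ∂(finitePart μ))) := fun g B ε hg =>
    tendsto_ratio_of_restr ζ ν μ hnull hlim hg
  have hhom : ∀ g B ε, IsTest g B ε → ∀ t : ℝ, 0 < t →
      ∫ x, g (t • x) ∂(finitePart μ) = t ^ α * ∫ x, g x ∂(finitePart μ) := by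
    intro g B ε hg t ht
    have ht' := inv_pos.2 ht
    -- The limit inherits its homogeneity from the normalising tail of `ν`, by comparing the scales
    -- `s` and `t⁻¹ * s`.
    have h1 := ((hall g B ε hg).comp (tendsto_id.const_mul_atTop ht')).mul (hνα t⁻¹ ht')
    rw [Real.inv_rpow ht.le, Real.rpow_neg ht.le, inv_inv, mul_comm] at h1
    refine tendsto_nhds_unique (hall _ _ _ (hg.comp_smul ht)) (h1.congr fun s => ?_)
    have h2 := ratio_comp_smul ζ ν g (u := t⁻¹) (s := s) (hν _).ne'
    rw [inv_inv] at h2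
    exact h2.symm
  refine ⟨μ, hμ, hnull, homogeneous_of_integral_compDilation μ α fun f t ht => ?_, hhom, hall⟩
  obtain ⟨B, ε, hf⟩ := exists_isTest_restr f
  have h1 := hhom _ _ _ hf t ht
  rw [integral_finitePart μ hnull _ f fun x => restr_of_ne f x.2,
    integral_finitePart μ hnull _ (compDilation f ht) fun x => ?_] at h1
  · exact h1
  · rw [← restr_compDilation f ht, restr_of_ne _ x.2]

/-- Normalising by the tail of `ζ` instead of that of `ν` divides every limit by `M`. -/
theorem isRegularlyVarying_smul_of_tendsto (ζ ν : Measure (EuclideanSpace ℝ (Fin d)))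
    (hν : ∀ s, 0 < tail ν s) {α : ℝ} (hα : 0 < α) (μ : Measure (ExtPunctured d))
    [IsFiniteMeasureOnCompacts μ] (hnull : μ (infinitePoints d) = 0)
    (hhom : ∀ t : ℝ, 0 < t → ∀ A : Set (ExtPunctured d), MeasurableSet A →
      μ (dilate t A) = ENNReal.ofReal (t ^ (-α)) * μ A)
    (hlim : ∀ g B ε, IsTest g B ε →
      Tendsto (ratio ζ ν g) atTop (𝓝 (∫ x, g x ∂(finitePart μ))))
    {M : ℝ} (hM : 0 < M) (hμM : tail (finitePart μ) 1 = M)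
    (htail : Tendsto (fun s => tail ζ s / tail ν s) atTop (𝓝 M)) :
    IsRegularlyVarying ζ α (ENNReal.ofReal M⁻¹ • μ) where
  index_pos := hα
  ne_zero h := by
    have h1 : finitePart (ENNReal.ofReal M⁻¹ • μ) {x | 1 < ‖x‖} = 0 := by
      rw [h]; simp [finitePart]
    rw [finitePart_smul, Measure.smul_apply, smul_eq_mul, mul_eq_zero] at h1
    rcases h1 with h1 | h1
    · exact absurd (ENNReal.ofReal_eq_zero.1 h1) (not_le.2 (inv_pos.2 hM))
    · rw [tail, Measure.real, h1, ENNReal.toReal_zero] at hμM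
      exact hM.ne hμM
  radon := ⟨fun K hK => by
    rw [Measure.smul_apply]
    exact ENNReal.mul_lt_top ENNReal.ofReal_lt_top hK.measure_lt_top⟩
  infinitePoints_null := by rw [Measure.smul_apply, hnull, smul_zero]
  tendsto f := by
    obtain ⟨B, ε, hf⟩ := exists_isTest_restr f
    have h1 := (hlim _ _ _ hf).div htail hM.ne'
    rw [integral_finitePart μ hnull _ f fun x => restr_of_ne f x.2] at h1
    rw [integral_smul_measure, ENNReal.toReal_ofReal (inv_pos.2 hM).le, smul_eq_mul,
      inv_mul_eq_div]
    refine h1.congr fun s => ?_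
    rw [integral_scaledRatio]
    exact ratio_change ζ ν ζ hν _ s
  homogeneous t ht A hA := by
    rw [Measure.smul_apply, Measure.smul_apply, hhom t ht A hA, smul_eq_mul, smul_eq_mul,
      mul_left_comm]

theorem indepFun_linear_sum {q : ℕ} {Ω : Type*} [MeasurableSpace Ω] {P : Measure Ω}
    {Z : Fin q → Ω → EuclideanSpace ℝ (Fin d)} (h : iIndepFun Z P)
    (hZ : ∀ j, AEMeasurable (Z j) P)
    (T : Fin q → EuclideanSpace ℝ (Fin d) →L[ℝ] EuclideanSpace ℝ (Fin d))
    (i : Fin q) (S : Finset (Fin q)) (hi : i ∉ S) :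
    IndepFun (Z i) (fun ω => ∑ j ∈ S, T j (Z j ω)) P := by
  -- The identity at `i` keeps `Z i` itself, rather than its linear image, on one side of the
  -- independence.
  let G : Fin q → EuclideanSpace ℝ (Fin d) → EuclideanSpace ℝ (Fin d) := fun j =>
    if j = i then id else T j
  have hG : ∀ j, Measurable (G j) := fun j => by
    by_cases hj : j = i
    · simp only [G, hj, if_true]; exact measurable_id
    · simp only [G, hj, if_false]; exact (T j).continuous.measurable
  have h1 := (iIndepFun.comp h G hG).indepFun_finsetSum_of_notMem₀
    (fun j => (hG j).comp_aemeasurable (hZ j)) hi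
  have h2 : G i ∘ Z i = Z i := by simp [G]
  have h3 : ∑ j ∈ S, G j ∘ Z j = fun ω => ∑ j ∈ S, T j (Z j ω) := by
    ext1 ω
    rw [Finset.sum_apply]
    refine Finset.sum_congr rfl fun j hj => ?_
    have : j ≠ i := fun h => hi (h ▸ hj)
    simp [G, this]
  rw [h2, h3] at h1
  exact h1.symm

theorem tail_linear_le {Ω : Type*} [MeasurableSpace Ω] (P : Measure Ω) [IsFiniteMeasure P]
    {Z : Ω → EuclideanSpace ℝ (Fin d)} (hZ : AEMeasurable Z P)
    (T : EuclideanSpace ℝ (Fin d) →L[ℝ] EuclideanSpace ℝ (Fin d)) {a : ℝ} (ha : 0 < a)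
    (hT : ‖T‖ ≤ a) (s : ℝ) :
    tail (P.map fun ω => T (Z ω)) s ≤ tail (P.map Z) (a⁻¹ * s) := by
  have hTZ : AEMeasurable (fun ω => T (Z ω)) P := T.continuous.measurable.comp_aemeasurable hZ
  rw [tail_map P hTZ, tail_map P hZ]
  refine measureReal_mono fun ω (hω : s < ‖T (Z ω)‖) => ?_
  change a⁻¹ * s < ‖Z ω‖
  rw [inv_mul_lt_iff₀ ha]
  exact hω.trans_le ((T.le_opNorm _).trans (mul_le_mul_of_nonneg_right hT (norm_nonneg _)))

end Main

theorem mainTheorem6 {d q : ℕ} [NeZero q] {Ω : Type*} [MeasurableSpace Ω]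
    (P : Measure Ω) [IsProbabilityMeasure P]
    (Ψ : Fin q → Matrix (Fin d) (Fin d) ℝ)
    (Z : Fin q → Ω → EuclideanSpace ℝ (Fin d))
    (hindep : iIndepFun Z P)
    (hident : ∀ i j, IdentDistrib (Z i) (Z j) P P)
    (X : Ω → EuclideanSpace ℝ (Fin d))
    (hX : ∀ ω, X ω = ∑ j, Matrix.toEuclideanCLM (𝕜 := ℝ) (Ψ j) (Z j ω))
    (α : ℝ) (μX : Measure (ExtPunctured d))
    (hXrv : IsRegularlyVarying (P.map X) α μX)
    (hΨ : ∀ j, IsUnit (Ψ j))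
    (hγ : ∑ j ∈ Finset.univ.erase (0 : Fin q), matrixOpNorm (Ψ j) ^ α
      < minStretch (Ψ 0) ^ α) :
    ∃ μZ : Measure (ExtPunctured d), ∀ i,
      IsRegularlyVarying (P.map (Z i)) α μZ ∧
      VagueTendsto (scaledRatio (P.map X) (P.map (Z i))) (∑ j, linearImage (Ψ j) μZ) := by
  have hα := hXrv.index_pos
  have hZ : ∀ j, AEMeasurable (Z j) P := fun j => (hident j j).aemeasurable_fst
  let T : Fin q → EuclideanSpace ℝ (Fin d) →L[ℝ] EuclideanSpace ℝ (Fin d) := fun j =>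
    Matrix.toEuclideanCLM (𝕜 := ℝ) (Ψ j)
  have hTZ : ∀ j, AEMeasurable (fun ω => T j (Z j ω)) P := fun j =>
    (T j).continuous.measurable.comp_aemeasurable (hZ j)
  have hXm : AEMeasurable X P := by
    rw [show X = fun ω => ∑ j, T j (Z j ω) from funext hX]
    exact Finset.aemeasurable_fun_sum _ fun j _ => hTZ j
  have := Measure.isProbabilityMeasure_map hXm
  have := Measure.isProbabilityMeasure_map (hZ 0)
  set ν := P.map X with hν_def
  set ζ := P.map (Z 0) with hζ_def
  have hζ : ∀ j, P.map (Z j) = ζ := fun j => (hident j 0).map_eq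
  have hνpos : ∀ s, 0 < tail ν s := hXrv.tail_pos
  have hνα : ∀ u : ℝ, 0 < u →
      Tendsto (fun s => tail ν (u * s) / tail ν s) atTop (𝓝 (u ^ (-α))) :=
    fun u hu => hXrv.tendsto_tail_div hu
  have hνconv : ∀ g B ε, IsTest g B ε →
      Tendsto (ratio ν ν g) atTop (𝓝 (∫ x, g x ∂(finitePart μX))) := fun g B ε hg => by
    have := hXrv.radon
    exact tendsto_ratio_of_restr ν ν μX hXrv.infinitePoints_null hXrv.tendsto_ratio_restr hg
  have hγ0 : 0 < minStretch (Ψ 0) := by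
    refine (minStretch_nonneg _).lt_of_ne fun h0 => ?_
    rw [← h0, Real.zero_rpow hα.ne'] at hγ
    exact absurd hγ (not_lt.2 (Finset.sum_nonneg fun j _ => Real.rpow_nonneg (norm_nonneg _) _))
  have := nontrivial_of_minStretch_pos hγ0
  set γ := minStretch (Ψ 0) with hγ_def
  -- the tail of `Z` is dominated by the tail of `X`
  obtain ⟨C, htail⟩ : ∃ C : ℝ, ∀ u : ℝ, 0 < u → ∀ᶠ s in atTop,
      tail ζ (u * s) ≤ C * u ^ (-α) * tail ν s := by
    refine ⟨_, fun u hu => eventually_tail_summand_le P hXm (hZ 0)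
      (Finset.aemeasurable_fun_sum (Finset.univ.erase 0) fun j _ => hTZ j)
      (indepFun_linear_sum hindep hZ T 0 _ (Finset.notMem_erase _ _)) (T 0) hγ0
      (minStretch_mul_norm_le (Ψ 0)) (fun ω => ?_) hνpos hνα hu⟩
    rw [hX, Finset.add_sum_erase _ (fun j => T j (Z j ω)) (Finset.mem_univ 0)]
  have hbound : ∀ g B ε, IsTest g B ε → ∀ᶠ s in atTop,
      |ratio ζ ν g s| ≤ C * (1 / 2) ^ (-α) * (B * ε ^ (-α)) := fun g B ε hg =>
    eventually_abs_ratio_le ζ ν hνpos htail hg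
  -- single big jump
  have hjump : ∀ g B ε, IsTest g B ε →
      Tendsto (fun s => ∑ j, ratio ζ ν (fun x => g (T j x)) s) atTop
        (𝓝 (∫ x, g x ∂(finitePart μX))) := by
    intro g B ε hg
    obtain ⟨a, ha⟩ : ∃ a : ℝ, ∀ j, ‖T j‖ ≤ a := Finite.bddAbove_range (fun j => ‖T j‖) |>.imp
      fun a ha j => ha ⟨j, rfl⟩
    -- A common positive bound for the norms, needed to divide by it.
    set b := max a 1 with hb
    have hb0 : 0 < b := lt_max_of_lt_right one_pos
    have htailY : ∀ j, ∀ u : ℝ, 0 < u → ∀ᶠ s in atTop,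
        tail (P.map fun ω => T j (Z j ω)) (u * s) ≤
          (C * (b⁻¹) ^ (-α)) * u ^ (-α) * tail ν s := by
      intro j u hu
      filter_upwards [htail (b⁻¹ * u) (by positivity)] with s hs
      refine (tail_linear_le P (hZ j) (T j) hb0 ((ha j).trans (le_max_left _ _)) _).trans ?_
      rw [hζ j, ← mul_assoc]
      refine hs.trans (le_of_eq ?_)
      rw [Real.mul_rpow (inv_pos.2 hb0).le hu.le]
      ring
    have h1 := tendsto_single_big_jump P hTZ
      (fun i j hij => (hindep.indepFun hij).comp (T i).continuous.measurable
        (T j).continuous.measurable) hνpos hα htailY hg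
    have h2 := (hνconv g B ε hg).sub h1
    rw [sub_zero] at h2
    refine h2.congr fun s => ?_
    rw [hν_def, ratio_map_eq P hXm _ hg.continuous, ← sub_div, ← hν_def]
    simp only [hX]
    rw [sub_sub_cancel, Finset.sum_div]
    refine Finset.sum_congr rfl fun j _ => ?_
    rw [← hζ j, ratio_map_eq P (hZ j) ν (g := fun x => g (T j x))
      (hg.continuous.comp (T j).continuous)]
    simp only [map_smul]
  -- convergence for `Z`
  have hconv : ∀ g B ε, IsTest g B ε → ∃ l, Tendsto (ratio ζ ν g) atTop (𝓝 l) := by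
    intro g B ε hg
    let T' := Matrix.toEuclideanCLM (𝕜 := ℝ) (Ψ 0)⁻¹
    have hT' : ∀ x, ‖T' x‖ ≤ γ⁻¹ * ‖x‖ := norm_toEuclideanCLM_inv_le (hΨ 0) hγ0
    refine exists_tendsto_of_contraction (Finset.univ.erase (0 : Fin q)) (ratio ζ ν) hbound
      (fun j x => T' (T j x)) (fun j => T'.continuous.comp (T j).continuous)
      (a := fun j => γ⁻¹ * matrixOpNorm (Ψ j))
      (fun j => mul_pos (inv_pos.2 hγ0) (matrixOpNorm_pos (hΨ j))) (fun j x => ?_) ?_ ?_ hg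
    · refine (hT' _).trans ?_
      rw [mul_assoc]
      exact mul_le_mul_of_nonneg_left ((T j).le_opNorm x) (inv_pos.2 hγ0).le
    -- After division by `γ ^ α`, the assumption on the matrices is exactly that the contraction
    -- factors sum to less than `1`.
    · have h1 : ∀ j, (γ⁻¹ * matrixOpNorm (Ψ j)) ^ α = (γ ^ α)⁻¹ * matrixOpNorm (Ψ j) ^ α :=
        fun j => by
          rw [Real.mul_rpow (inv_pos.2 hγ0).le (matrixOpNorm_pos (hΨ j)).le, Real.inv_rpow hγ0.le]
      simp only [h1]
      rw [← Finset.mul_sum, inv_mul_lt_iff₀ (by positivity), mul_one]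
      exact hγ
    · intro g B ε hg
      -- The single big jump is applied to `g ∘ T'`, which turns the term of index `0` into `g`
      -- itself.
      refine ⟨_, (hjump _ _ _ (hg.comp_of_norm_le T'.continuous (inv_pos.2 hγ0) hT')).congr
        fun s => ?_⟩
      rw [← Finset.add_sum_erase _ _ (Finset.mem_univ 0)]
      congr 2
      ext x
      rw [toEuclideanCLM_nonsing_inv_mul (hΨ 0)]
  obtain ⟨μ, hμ, hnull, hhomA, hhom, hlim⟩ :=
    exists_homogeneous_measure ζ ν hνpos hα hνα hbound hconv
  have hfin : ∀ ε : ℝ, 0 < ε → finitePart μ {x | ε ≤ ‖x‖} < ⊤ := fun ε hε =>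
    finitePart_norm_ge_lt_top μ hε
  have hint : ∀ g B ε, IsTest g B ε → Integrable g (finitePart μ) := fun g B ε hg =>
    hg.integrable_finitePart μ
  -- Comparing two limits of the same sum expresses `μX` through `μ`. It yields the positivity of
  -- `M`, since `μX` is non-null, and identifies the limit in the conclusion.
  have hsum : ∀ g B ε, IsTest g B ε →
      ∫ x, g x ∂(finitePart μX) = ∑ j, ∫ x, g (T j x) ∂(finitePart μ) := fun g B ε hg =>
    tendsto_nhds_unique (hjump g B ε hg)
      (tendsto_finsetSum _ fun j _ => hlim _ _ _ (hg.comp_toEuclideanCLM (hΨ j)))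
  have hM : 0 < tail (finitePart μ) 1 := by
    obtain ⟨f, hf0⟩ := hXrv.exists_integral_ne_zero
    obtain ⟨B, ε, hf⟩ := exists_isTest_restr f
    rw [← integral_finitePart μX hXrv.infinitePoints_null _ f fun x => restr_of_ne f x.2,
      hsum _ _ _ hf] at hf0
    obtain ⟨j, -, hj⟩ := Finset.exists_ne_zero_of_sum_ne_zero hf0
    exact tail_one_pos_of_integral_ne_zero _ hfin hint hhom (hf.comp_toEuclideanCLM (hΨ j)) hj
  have hratio := tendsto_tail_div_of_tendsto_ratio ζ ν hνpos _ hfin hint hhom hlim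
  have hrv := isRegularlyVarying_smul_of_tendsto ζ ν hνpos hα μ hnull hhomA hlim hM rfl hratio
  refine ⟨ENNReal.ofReal (tail (finitePart μ) 1)⁻¹ • μ, fun i => ?_⟩
  rw [hζ i]
  refine ⟨hrv, fun f => ?_⟩
  obtain ⟨B, ε, hf⟩ := exists_isTest_restr f
  have := hrv.radon
  rw [integral_finsetSum_measure fun j _ => integrable_linearImage f (hΨ j) _]
  simp only [integral_linearImage, finitePart_smul, integral_smul_measure,
    ENNReal.toReal_ofReal (inv_pos.2 hM).le, smul_eq_mul]
  rw [← Finset.mul_sum, inv_mul_eq_div]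
  have h1 := (hνconv _ _ _ hf).div hratio hM.ne'
  rw [hsum _ _ _ hf] at h1
  refine h1.congr fun s => ?_
  rw [integral_scaledRatio]
  exact ratio_change ν ν ζ hνpos _ s
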